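/- Let $N\ge 1$, $Q=(0,1)^N$, $s\in(0,1)$ and $p\in[1,\infty]$. For $w:(0,1)\to\mathbb R$ let $$d_R^s w(x)=-\frac1{\Gamma(1-s)}\frac{d}{dx}\int_x^1\frac{w(t)}{(t-x)^s}\,dt$$ be the right-sided Riemann–Liouville derivative, let $\partial^s_{i,R}$ be the same operation in the variable $x_i$, and for $\varphi\in C_c^\infty(Q;\mathbb R^N)$ put $$\operatorname{div}^s\varphi=\Big[\big(1-\tfrac1N\big)s+\tfrac1N\Big]\sum_{i=1}^N\partial^s_{i,R}\varphi_i .$$ For $q\in[1,\infty]$ and $u\in L^1(Q)$ define $$TV^s_{\ell^q}(u)=\sup\Big\{\int_Q u\,\operatorname{div}^s\varphi\,dx:\ \varphi\in C_c^\infty(Q;\mathbb R^N),\ |\varphi|^*_{\ell^q}\le 1\Big\},$$ where $|\cdot|^*_{\ell^q}$ is the dual norm of the $\ell^q$ norm on $\mathbb R^N$. Let $BV^s(Q)$ be the set of $u\in L^1(Q)$ with $TV^s_{\ell^q}(u)<\infty$ for all $q\in[1,\infty]$, and let $\|u\|_{BV^s(Q)}=\|u\|_{L^1(Q)}+TV^s_{\ell^p}(u)$.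 Let $SV^s(Q)$ be the set of $u\in L^1(Q)$ such that for every $q\in[1,\infty]$ we have $TV^s_{\ell^q}(u)<\infty$ and there are $v_m\in C^\infty(Q)\cap L^1(Q)$ with $TV^s_{\ell^q}(v_m)<\infty$, $v_m\to u$ in $L^1(Q)$ and $TV^s_{\ell^q}(v_m)\to TV^s_{\ell^q}(u)$. Let $BV(Q)$ be the classical space of functions of bounded variation; for $u\in BV(Q)$ let $\|u\|_{L^\infty(\partial Q)}$ be the $L^\infty(\partial Q,\mathcal H^{N-1})$ norm of its boundary trace $T[u]$, which is characterized by $\lim_{\varepsilon\to0}\frac{1}{|B(x_0,\varepsilon)\cap Q|}\int_{B(x_0,\varepsilon)\cap Q}|u-T[u](x_0)|\,dx=0$ for $\mathcal H^{N-1}$-a.e. $x_0\in\partial Q$. **Theorem.** Let $(u_n)_{n\in\mathbb N}\subset SV^s(Q)\cap BV(Q)$ satisfy $$\sup_{n\in\mathbb N}\big(\|u_n\|_{L^\infty(\partial Q)}+\|u_n\|_{BV^s(Q)}\big)<\infty .$$ Then there exist $u\in BV^s(Q)$ and a subsequence of $(u_n)$ that converges to $u$ strongly in $L^1(Q)$.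 -/

import Mathlib

open MeasureTheory Filter Topology Set
open scoped ENNReal ContDiff

noncomputable section

namespace FracBV

/-- The open unit cube `Q = (0,1)^N`. -/
def cube (N : ℕ) : Set (Fin N → ℝ) :=
  Set.pi Set.univ fun _ => Set.Ioo (0 : ℝ) 1

/-- The right-sided Riemann–Liouville derivative of order `s ∈ (0,1)` on `(0,1)`:
`d_R^s w (x) = - 1/Γ(1-s) · d/dx ∫_x^1 w(t) (t-x)^{-s} dt`. -/
def rlDerivRight (s : ℝ) (w : ℝ → ℝ) (x : ℝ) : ℝ :=
  -(1 / Real.Gamma (1 - s)) * deriv (fun y => ∫ t in y..1, w t / (t - y) ^ s) x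

/-- The right-sided fractional partial derivative `∂_{i,R}^s f`. -/
def rlPartialRight {N : ℕ} (s : ℝ) (i : Fin N) (f : (Fin N → ℝ) → ℝ) (x : Fin N → ℝ) : ℝ :=
  rlDerivRight s (fun t => f (Function.update x i t)) (x i)

/-- The (scaled) fractional divergence of order `s`. -/
def fracDiv {N : ℕ} (s : ℝ) (φ : (Fin N → ℝ) → (Fin N → ℝ)) (x : Fin N → ℝ) : ℝ :=
  ((1 - 1 / (N : ℝ)) * s + 1 / (N : ℝ)) * ∑ i, rlPartialRight s i (fun y => φ y i) x

/-- The classical divergence. -/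
def classicalDiv {N : ℕ} (φ : (Fin N → ℝ) → (Fin N → ℝ)) (x : Fin N → ℝ) : ℝ :=
  ∑ i, deriv (fun t => φ (Function.update x i t) i) (x i)

/-- The dual norm of the `ℓ^p` norm on `ℝ^N`. -/
def dualNorm {N : ℕ} (p : ℝ≥0∞) (y : Fin N → ℝ) : ℝ :=
  sSup {t : ℝ | ∃ x : Fin N → ℝ, ‖WithLp.toLp p x‖ ≤ 1 ∧ t = ∑ i, x i * y i}

/-- Admissible test fields: `φ ∈ C_c^∞(Q; ℝ^N)` with `|φ|_{ℓ^p}^* ≤ 1`. -/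
structure IsTestField {N : ℕ} (p : ℝ≥0∞) (φ : (Fin N → ℝ) → (Fin N → ℝ)) : Prop where
  smooth : ContDiff ℝ ∞ φ
  compactSupport : HasCompactSupport φ
  support_subset : tsupport φ ⊆ cube N
  dualNorm_le : ∀ x, dualNorm p (φ x) ≤ 1

/-- `sup { ∫_Q u D(φ) dx : φ ∈ C_c^∞(Q; ℝ^N), |φ|_{ℓ^p}^* ≤ 1 } ∈ [0,∞]`. The truncation by
`ENNReal.ofReal` does not change the supremum, as `φ = 0` is admissible. -/
def variation {N : ℕ} (D : ((Fin N → ℝ) → (Fin N → ℝ)) → (Fin N → ℝ) → ℝ)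
    (p : ℝ≥0∞) (u : (Fin N → ℝ) → ℝ) : ℝ≥0∞ :=
  ⨆ (φ : (Fin N → ℝ) → (Fin N → ℝ)) (_ : IsTestField p φ),
    ENNReal.ofReal (∫ x in cube N, u x * D φ x)

/-- The first order total variation `TV_{ℓ^p}`. -/
def TV {N : ℕ} (p : ℝ≥0∞) (u : (Fin N → ℝ) → ℝ) : ℝ≥0∞ :=
  variation classicalDiv p u

/-- The fractional total variation `TV^s_{ℓ^p}`, `s ∈ (0,1)`. -/
def fracTV {N : ℕ} (s : ℝ) (p : ℝ≥0∞) (u : (Fin N → ℝ) → ℝ) : ℝ≥0∞ :=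
  variation (fracDiv s) p u

/-- The `L^1(Q)` norm. -/
def normL1 {N : ℕ} (u : (Fin N → ℝ) → ℝ) : ℝ≥0∞ :=
  eLpNorm u 1 (volume.restrict (cube N))

/-- `u ∈ BV(Q)`. -/
def MemBV {N : ℕ} (u : (Fin N → ℝ) → ℝ) : Prop :=
  IntegrableOn u (cube N) ∧ TV 2 u < ⊤

/-- `u ∈ BV^s(Q)`. -/
def MemFracBV {N : ℕ} (s : ℝ) (u : (Fin N → ℝ) → ℝ) : Prop :=
  IntegrableOn u (cube N) ∧ ∀ p : ℝ≥0∞, 1 ≤ p → fracTV s p u < ⊤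

/-- `‖u‖_{BV^s(Q)} = ‖u‖_{L^1(Q)} + TV^s_{ℓ^p}(u)`. -/
def fracBVNorm {N : ℕ} (s : ℝ) (p : ℝ≥0∞) (u : (Fin N → ℝ) → ℝ) : ℝ≥0∞ :=
  normL1 u + fracTV s p u

/-- Strict convergence `v n → u` with respect to `TV^s_{ℓ^p}`. All total variations are finite,
so convergence in `[0,∞]` is convergence of real numbers. -/
structure StrictConv {N : ℕ} (s : ℝ) (p : ℝ≥0∞)
    (v : ℕ → (Fin N → ℝ) → ℝ) (u : (Fin N → ℝ) → ℝ) : Prop where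
  integrable : ∀ n, IntegrableOn (v n) (cube N)
  integrable_lim : IntegrableOn u (cube N)
  finite : ∀ n, fracTV s p (v n) < ⊤
  finite_lim : fracTV s p u < ⊤
  tendsto_L1 : Tendsto (fun n => normL1 (fun x => v n x - u x)) atTop (𝓝 0)
  tendsto_TV : Tendsto (fun n => fracTV s p (v n)) atTop (𝓝 (fracTV s p u))

/-- `u ∈ SV^s(Q)`: for every `p ∈ [1,∞]`, `u` is the strict `TV^s_{ℓ^p}` limit of functions
in `C^∞(Q)`. -/
def MemSV {N : ℕ} (s : ℝ) (u : (Fin N → ℝ) → ℝ) : Prop :=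
  ∀ p : ℝ≥0∞, 1 ≤ p → ∃ v : ℕ → (Fin N → ℝ) → ℝ,
    (∀ n, ContDiffOn ℝ ∞ (v n) (cube N)) ∧ StrictConv s p v u

/-- The surface measure on `∂Q`: the `(N-1)`-dimensional Hausdorff measure of the Euclidean
distance. -/
def surfaceMeasure (N : ℕ) : Measure (Fin N → ℝ) :=
  (Measure.map (fun x : EuclideanSpace ℝ (Fin N) => x.ofLp)
    (Measure.hausdorffMeasure ((N : ℝ) - 1))).restrict (frontier (cube N))

/-- `B(x, ε) ∩ Q` with the Euclidean ball `B(x, ε)`. -/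
def ballInCube {N : ℕ} (x : Fin N → ℝ) (ε : ℝ) : Set (Fin N → ℝ) :=
  {y | ‖WithLp.toLp 2 y - WithLp.toLp 2 x‖ < ε} ∩ cube N

/-- `g` is the boundary trace `T[u]` of `u`: for almost every `x₀ ∈ ∂Q`, the averages of
`|u - g(x₀)|` over `B(x₀, ε) ∩ Q` tend to `0` as `ε → 0`. -/
def IsTrace {N : ℕ} (u g : (Fin N → ℝ) → ℝ) : Prop :=
  ∀ᵐ x₀ ∂(surfaceMeasure N),
    Tendsto (fun ε : ℝ => ⨍ y in ballInCube x₀ ε, |u y - g x₀|) (𝓝[>] 0) (𝓝 0)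

/-- `‖u‖_{L^∞(∂Q)}`, the essential supremum on `∂Q` of the modulus of the trace of `u`.
A trace is unique almost everywhere on `∂Q`, so the infimum is over a single value if `u` has a
trace, as every `u ∈ BV(Q)` does. -/
def boundaryNorm {N : ℕ} (u : (Fin N → ℝ) → ℝ) : ℝ≥0∞ :=
  ⨅ (g : (Fin N → ℝ) → ℝ) (_ : IsTrace u g), eLpNormEssSup g (surfaceMeasure N)

end FracBV

end

/-! Compactness in `L¹` follows from the Kolmogorov–Riesz criterion once the translates of a
function of bounded fractional variation are small in `L¹`, uniformly under a bound on the `BV^s`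
norm. The difference of `u` and a translate is estimated by duality, so the task is to bound `∫ u f`
for a test function `f = ψ(· - h eᵢ) - ψ`.

Let `W` be the right-sided fractional integral of order `s` of `f` in the variable `xᵢ` (`dirFrac s
i f`, unnormalized). By Abel's inversion (`abel_inversion`) the fractional derivative of `W` is a
multiple of `f`, so `∫ u f` would be at most a constant times `sup |W|` times the variation, if `W`
were compactly supported in the cube. It is not: integration to the right spreads the support
towards the face `xᵢ = 0`. Hence the face value of `W` is subtracted, multiplied by a fixed profile,
and the remainder `V`, which vanishes linearly at the face, is cut off at scale `ε`. The first
correction costs `sup |W|` times the `L¹` norm. The second tends to `0` with `ε`, because the slope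
`1/ε` of the cutoff meets `|V| = O(ε)` and the kernel is integrable (`exists_cutoff_error_bound`).
This gives `exists_integral_mul_le`.

For the `f` above, the translation can be moved from `ψ` to the kernel, so that `sup |W|` is at most
the `L¹` modulus of continuity of an integrable function (`abs_dirFrac_translate_sub_le`,
`tendsto_kernelModulus`). This yields `exists_setIntegral_translate_sub_le`. Averaging over small
cells then proves total boundedness (`exists_tendsto_subseq`), and lower semicontinuity puts the
limit in `BV^s` (`fracTV_lt_top_of_tendsto`). -/

noncomputable section

namespace FracBV

/-! ### One-dimensional fractional integrals and Abel's inversion -/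

/-- The truncated Riemann–Liouville kernel `r ↦ r^(a-1)` on `(0,1]`, extended by zero. -/
def fracKernel (a : ℝ) : ℝ → ℝ :=
  (Ioc (0 : ℝ) 1).indicator fun r => r ^ (a - 1)

lemma fracKernel_nonneg (a r : ℝ) : 0 ≤ fracKernel a r :=
  indicator_nonneg (fun _ hr => Real.rpow_nonneg hr.1.le _) _

lemma integrable_fracKernel {a : ℝ} (ha : 0 < a) : Integrable (fracKernel a) := by
  refine IntegrableOn.integrable_indicator ?_ measurableSet_Ioc
  rw [← intervalIntegrable_iff_integrableOn_Ioc_of_le zero_le_one]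
  exact intervalIntegral.intervalIntegrable_rpow' (by linarith)

/-- Integration of `g` against the truncated kernel, starting from `y`. -/
def lineFrac (a : ℝ) (g : ℝ → ℝ) (y : ℝ) : ℝ :=
  ∫ r, fracKernel a r * g (y + r)

lemma integrable_kernel_mul {k g : ℝ → ℝ} (hk : Integrable k) (hg : Continuous g)
    {C : ℝ} (hC : ∀ t, |g t| ≤ C) (y : ℝ) : Integrable fun r => k r * g (y + r) :=
  hk.mul_bdd (c := C) (by fun_prop) (ae_of_all _ fun r => by simpa using hC (y + r))

/-- The variable `y` enters only through `v`, so the singularity of the kernel is never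
differentiated and `|k| C'` dominates the difference quotients. -/
lemma hasDerivAt_integral_kernel {k v v' : ℝ → ℝ} (hk : Integrable k)
    (hv : ∀ t, HasDerivAt v (v' t) t) (hv' : Continuous v') {C C' : ℝ} (hC : ∀ t, |v t| ≤ C)
    (hC' : ∀ t, |v' t| ≤ C') (y : ℝ) :
    HasDerivAt (fun y => ∫ r, k r * v (y + r)) (∫ r, k r * v' (y + r)) y := by
  have hvc : Continuous v := continuous_iff_continuousAt.2 fun t => (hv t).continuousAt
  refine (hasDerivAt_integral_of_dominated_loc_of_deriv_le (μ := volume)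
    (F := fun y r => k r * v (y + r)) (F' := fun y r => k r * v' (y + r))
    (bound := fun r => |k r| * C') (s := univ)
    univ_mem (Eventually.of_forall fun z => ?_) ?_ ?_ ?_ ?_ ?_).2
  · exact (integrable_kernel_mul hk hvc hC z).aestronglyMeasurable
  · exact integrable_kernel_mul hk hvc hC y
  · exact (integrable_kernel_mul hk hv' hC' y).aestronglyMeasurable
  · refine ae_of_all _ fun r z _ => ?_
    rw [norm_mul, Real.norm_eq_abs, Real.norm_eq_abs]
    exact mul_le_mul_of_nonneg_left (hC' _) (abs_nonneg _)
  · exact hk.abs.mul_const _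
  · refine ae_of_all _ fun r z _ => ?_
    exact ((hv (z + r)).comp_add_const z r).const_mul _

/-- Truncating the kernel at length `1` loses nothing: `[y, y + 1]` covers `[y, 1]`, and `g`
vanishes beyond `1`. -/
lemma integral_kernel_eq_intervalIntegral {a y : ℝ} (g : ℝ → ℝ) (hy : y ∈ Ioo (0 : ℝ) 1)
    (hg : ∀ t, 1 ≤ t → g t = 0) :
    lineFrac a g y = ∫ t in y..1, g t * (t - y) ^ (a - 1) := by
  have h1 : lineFrac a g y = ∫ r in (0 : ℝ)..1, g (y + r) * r ^ (a - 1) := by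
    rw [intervalIntegral.integral_of_le zero_le_one, ← integral_indicator measurableSet_Ioc,
      lineFrac]
    congr 1 with r
    by_cases hr : r ∈ Ioc (0 : ℝ) 1 <;> simp [fracKernel, hr, mul_comm]
  have h2 : ∫ t in y..1, g t * (t - y) ^ (a - 1) = ∫ t in y..(y + 1), g t * (t - y) ^ (a - 1) := by
    rw [intervalIntegral.integral_of_le hy.2.le, intervalIntegral.integral_of_le (by linarith)]
    refine setIntegral_eq_of_subset_of_forall_sdiff_eq_zero measurableSet_Ioc
      (Ioc_subset_Ioc_right (by linarith [hy.1])) (fun t ht => ?_) |>.symm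
    have : 1 ≤ t := by
      by_contra h
      exact ht.2 ⟨ht.1.1, by linarith⟩
    simp [hg t this]
  rw [h1, h2]
  have := intervalIntegral.integral_comp_add_left (fun t => g t * (t - y) ^ (a - 1)) y
    (a := 0) (b := 1)
  simpa using this

/-- Because `v` vanishes at the right endpoint, the Riemann–Liouville and Caputo derivatives agree:
no boundary term appears when the derivative moves onto `v`. -/
lemma rlDerivRight_eq {s : ℝ} (hs : s < 1) {v v' : ℝ → ℝ}
    (hv : ∀ t, HasDerivAt v (v' t) t) (hv' : Continuous v') {C C' : ℝ} (hC : ∀ t, |v t| ≤ C)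
    (hC' : ∀ t, |v' t| ≤ C') (h0 : ∀ t, 1 ≤ t → v t = 0) {x : ℝ} (hx : x ∈ Ioo (0 : ℝ) 1) :
    rlDerivRight s v x = -(1 / Real.Gamma (1 - s)) * lineFrac (1 - s) v' x := by
  rw [rlDerivRight]
  congr 1
  have h := hasDerivAt_integral_kernel (integrable_fracKernel (a := 1 - s) (by linarith))
    hv hv' hC hC' x
  refine HasDerivAt.deriv (h.congr_of_eventuallyEq ?_)
  filter_upwards [isOpen_Ioo.mem_nhds hx] with y hy
  have := integral_kernel_eq_intervalIntegral (a := 1 - s) v hy h0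
  rw [lineFrac] at this
  rw [this]
  refine intervalIntegral.integral_congr_ae (ae_of_all _ fun t ht => ?_)
  rw [uIoc_of_le hy.2.le] at ht
  rw [show 1 - s - 1 = -s by ring, Real.rpow_neg (by linarith [ht.1]), div_eq_mul_inv]

/-- The constant of Abel's inversion, the Beta integral `B(1-s,s)`. -/
def abelConst (s : ℝ) : ℝ :=
  ∫ r, fracKernel (1 - s) r * fracKernel s (1 - r)

/-- The exponents `-s` and `s - 1` add up to `-1`. The condition `z ≤ 1` keeps both truncations
inactive for `r` in `(0,1)`; for other `r` both sides vanish. -/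
lemma kernel_mul_kernel_scaled {s z : ℝ} (hz : z ∈ Ioc (0 : ℝ) 1) (r : ℝ) :
    fracKernel (1 - s) (z * r) * fracKernel s (z - z * r)
      = z⁻¹ * (fracKernel (1 - s) r * fracKernel s (1 - r)) := by
  by_cases hr : r ∈ Ioo (0 : ℝ) 1
  · have hz0 := hz.1
    have m1 : z * r ∈ Ioc (0 : ℝ) 1 := ⟨mul_pos hz0 hr.1, by nlinarith [hz.2, hr.2, hr.1]⟩
    have e : z - z * r = z * (1 - r) := by ring
    have m2 : z * (1 - r) ∈ Ioc (0 : ℝ) 1 :=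
      ⟨mul_pos hz0 (by linarith [hr.2]), by nlinarith [hz.2, hr.2, hr.1]⟩
    have m3 : r ∈ Ioc (0 : ℝ) 1 := ⟨hr.1, hr.2.le⟩
    have m4 : 1 - r ∈ Ioc (0 : ℝ) 1 := ⟨by linarith [hr.2], by linarith [hr.1]⟩
    rw [e]
    simp only [fracKernel, indicator_of_mem m1, indicator_of_mem m2, indicator_of_mem m3,
      indicator_of_mem m4]
    rw [Real.mul_rpow hz0.le m3.1.le, Real.mul_rpow hz0.le m4.1.le]
    have : z ^ (1 - s - 1) * z ^ (s - 1) = z⁻¹ := by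
      rw [← Real.rpow_add hz0, ← Real.rpow_neg_one]; congr 1; ring
    rw [← this]; ring
  · have hz0 := hz.1
    have l : fracKernel (1 - s) r * fracKernel s (1 - r) = 0 := by
      by_cases h0 : 0 < r
      · have : (1 - r) ∉ Ioc (0 : ℝ) 1 := fun h => hr ⟨h0, by linarith [h.1]⟩
        simp [fracKernel, this]
      · have : r ∉ Ioc (0 : ℝ) 1 := fun h => h0 h.1
        simp [fracKernel, this]
    have l' : fracKernel (1 - s) (z * r) * fracKernel s (z - z * r) = 0 := by
      by_cases h0 : 0 < r
      · have : (z - z * r) ∉ Ioc (0 : ℝ) 1 := fun h => hr ⟨h0, by nlinarith [h.1]⟩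
        simp [fracKernel, this]
      · have : z * r ∉ Ioc (0 : ℝ) 1 := fun h => h0 (pos_of_mul_pos_right h.1 hz0.le)
        simp [fracKernel, this]
    rw [l, l', mul_zero]

lemma integral_kernel_conv {s z : ℝ} (hz : z ∈ Ioc (0 : ℝ) 1) :
    ∫ r, fracKernel (1 - s) r * fracKernel s (z - r) = abelConst s := by
  have h := Measure.integral_comp_mul_left
    (fun r => fracKernel (1 - s) r * fracKernel s (z - r)) z
  simp only [kernel_mul_kernel_scaled hz, integral_const_mul, smul_eq_mul, abs_of_pos (inv_pos.2 hz.1)] at h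
  exact (mul_left_cancel₀ (inv_pos.2 hz.1).ne' h).symm

lemma integrable_abel {s : ℝ} (hs : s ∈ Ioo (0 : ℝ) 1) {g : ℝ → ℝ} (hg : Continuous g) {C : ℝ}
    (hC : ∀ t, |g t| ≤ C) :
    Integrable (fun p : ℝ × ℝ =>
      (fracKernel (1 - s) p.2 * fracKernel s (p.1 - p.2)) * g p.1) (volume.prod volume) := by
  have h1 := (integrable_fracKernel (a := 1 - s) (by linarith [hs.2])).convolution_integrand
    (ContinuousLinearMap.mul ℝ ℝ) (integrable_fracKernel hs.1)
  refine Integrable.mul_bdd (c := C) h1 ?_ (ae_of_all _ fun p => by simpa using hC p.1)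
  exact (hg.comp continuous_fst).aestronglyMeasurable

/-- Fubini turns the iterated integral into one against the convolution of the two kernels, which is
constant on `(0,1]`; what remains is a plain integral of `g`. -/
lemma abel_inversion_zero {s : ℝ} (hs : s ∈ Ioo (0 : ℝ) 1) {g : ℝ → ℝ} (hg : Continuous g) {C : ℝ}
    (hC : ∀ t, |g t| ≤ C) (h0 : ∀ t, 1 ≤ t → g t = 0) :
    lineFrac (1 - s) (lineFrac s g) 0 = abelConst s * ∫ z in (0 : ℝ)..1, g z := by
  have hint := integrable_abel hs hg hC
  calc lineFrac (1 - s) (lineFrac s g) 0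
      = ∫ r, ∫ z, (fracKernel (1 - s) r * fracKernel s (z - r)) * g z := by
        simp only [lineFrac]
        congr 1 with r
        rw [← integral_add_left_eq_self
          (fun z => (fracKernel (1 - s) r * fracKernel s (z - r)) * g z) r, ← integral_const_mul]
        congr 1 with z
        rw [add_sub_cancel_left, zero_add, mul_assoc]
    _ = ∫ z, ∫ r, (fracKernel (1 - s) r * fracKernel s (z - r)) * g z :=
        (integral_integral_swap hint).symm
    _ = ∫ z, (Ioc (0 : ℝ) 1).indicator (fun z => abelConst s * g z) z := by
        congr 1 with z
        rw [integral_mul_const]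
        by_cases hz : z ∈ Ioc (0 : ℝ) 1
        · rw [integral_kernel_conv hz, indicator_of_mem hz]
        · rw [indicator_of_notMem hz]
          by_cases h1 : 1 ≤ z
          · rw [h0 z h1, mul_zero]
          · have hz' : z ≤ 0 := by
              by_contra h
              exact hz ⟨not_le.1 h, (not_le.1 h1).le⟩
            have : ∀ r, fracKernel (1 - s) r * fracKernel s (z - r) = 0 := by
              intro r
              by_cases hr : 0 < r
              · have : z - r ∉ Ioc (0 : ℝ) 1 := fun h => by linarith [h.1]
                simp [fracKernel, this]
              · have : r ∉ Ioc (0 : ℝ) 1 := fun h => hr h.1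
                simp [fracKernel, this]
            simp [this]
    _ = _ := by
        rw [integral_indicator measurableSet_Ioc, intervalIntegral.integral_of_le zero_le_one,
          integral_const_mul]

/-- Abel's inversion formula. -/
lemma abel_inversion {s : ℝ} (hs : s ∈ Ioo (0 : ℝ) 1) {v v' : ℝ → ℝ}
    (hv : ∀ t, HasDerivAt v (v' t) t) (hv' : Continuous v') {C : ℝ}
    (hC : ∀ t, |v' t| ≤ C) (h0 : ∀ t, 1 ≤ t → v t = 0) {x : ℝ} (hx : 0 ≤ x) :
    lineFrac (1 - s) (lineFrac s v') x = - abelConst s * v x := by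
  -- At `t = 1` the function `v` is known to vanish only to the right, hence one-sided derivatives.
  have h0' : ∀ t, 1 ≤ t → v' t = 0 := by
    intro t ht
    have h1 : HasDerivWithinAt v (v' t) (Ici t) t := (hv t).hasDerivWithinAt
    have h2 : HasDerivWithinAt v 0 (Ici t) t :=
      (hasDerivWithinAt_const t (Ici t) (0 : ℝ)).congr (fun y hy => h0 y (ht.trans hy)) (h0 t ht)
    exact (uniqueDiffWithinAt_Ici t).eq_deriv _ h1 h2
  have h := abel_inversion_zero hs (g := fun t => v' (x + t)) (by fun_prop)
    (fun t => hC _) (fun t ht => h0' _ (by linarith))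
  have e : ∫ z in (0 : ℝ)..1, v' (x + z) = - v x := by
    rw [intervalIntegral.integral_eq_sub_of_hasDerivAt (f := fun z => v (x + z))
      (fun z _ => (hv (x + z)).comp_const_add x z)
      ((hv'.comp (by fun_prop)).intervalIntegrable _ _), h0 (x + 1) (by linarith)]
    simp
  rw [e] at h
  rw [neg_mul, ← mul_neg, ← h]
  simp only [lineFrac, zero_add, add_assoc]

/-- Integrability has to be shown, since a divergent integral would have the value `0`. Fubini gives
it for almost every convolution point `z`, and scaling transports it from one such `z` to `1`. -/
lemma abelConst_pos {s : ℝ} (hs : s ∈ Ioo (0 : ℝ) 1) : 0 < abelConst s := by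
  have hae := ((integrable_fracKernel (a := 1 - s) (by linarith [hs.2])).convolution_integrand
    (ContinuousLinearMap.mul ℝ ℝ) (integrable_fracKernel hs.1)).prod_right_ae
  obtain ⟨z, hz, hint⟩ : ∃ z ∈ Ioc (0 : ℝ) 1,
      Integrable fun r => fracKernel (1 - s) r * fracKernel s (z - r) := by
    have : (volume.restrict (Ioc (0 : ℝ) 1)) ≠ 0 := by simp
    have : NeBot (ae (volume.restrict (Ioc (0 : ℝ) 1))) := ae_neBot.2 this
    obtain ⟨z, h1, h2⟩ := ((ae_restrict_of_ae (s := Ioc (0 : ℝ) 1) hae).and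
      (ae_restrict_mem measurableSet_Ioc)).exists
    exact ⟨z, h2, by simpa using h1⟩
  have h := hint.comp_mul_left' hz.1.ne'
  simp only [kernel_mul_kernel_scaled hz] at h
  rw [integrable_const_mul_iff (inv_pos.2 hz.1).ne'.isUnit] at h
  rw [abelConst, integral_pos_iff_support_of_nonneg
    (fun r => mul_nonneg (fracKernel_nonneg _ _) (fracKernel_nonneg _ _)) h]
  refine lt_of_lt_of_le ?_ (measure_mono (s := Ioo (0 : ℝ) 1) fun r hr => ?_)
  · simp
  · have m3 : r ∈ Ioc (0 : ℝ) 1 := ⟨hr.1, hr.2.le⟩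
    have m4 : 1 - r ∈ Ioc (0 : ℝ) 1 := ⟨by linarith [hr.2], by linarith [hr.1]⟩
    simp only [Function.mem_support, fracKernel, indicator_of_mem m3, indicator_of_mem m4]
    exact (mul_pos (Real.rpow_pos_of_pos m3.1 _) (Real.rpow_pos_of_pos m4.1 _)).ne'

/-! ### Fractional integrals in a coordinate direction -/

variable {N : ℕ}

lemma update_eq_add (x : Fin N → ℝ) (i : Fin N) (t : ℝ) :
    Function.update x i t = x + (t - x i) • Pi.single i (1 : ℝ) := by
  ext j
  by_cases h : j = i
  · subst h; simp
  · simp [h]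

/-- The partial derivative in the direction of the `i`-th coordinate. -/
def partialDeriv (i : Fin N) (f : (Fin N → ℝ) → ℝ) (x : Fin N → ℝ) : ℝ :=
  fderiv ℝ f x (Pi.single i 1)

lemma hasDerivAt_update_line {f : (Fin N → ℝ) → ℝ} (hf : Differentiable ℝ f) (i : Fin N)
    (x : Fin N → ℝ) (t : ℝ) :
    HasDerivAt (fun t => f (Function.update x i t)) (partialDeriv i f (Function.update x i t)) t := by
  have h := (hf (Function.update x i t)).hasFDerivAt.comp_hasDerivAt t (hasDerivAt_update x i t)
  exact h

lemma continuous_partialDeriv {f : (Fin N → ℝ) → ℝ} (hf : ContDiff ℝ 1 f) (i : Fin N) :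
    Continuous (partialDeriv i f) :=
  (hf.continuous_fderiv one_ne_zero).clm_apply continuous_const

lemma exists_bound_of_hasCompactSupport {f : (Fin N → ℝ) → ℝ} (hf : Continuous f)
    (hc : HasCompactSupport f) : ∃ C, ∀ x, |f x| ≤ C := by
  simpa using hf.bounded_above_of_compact_support hc

lemma hasCompactSupport_partialDeriv {f : (Fin N → ℝ) → ℝ}
    (hc : HasCompactSupport f) (i : Fin N) : HasCompactSupport (partialDeriv i f) :=
  (hc.fderiv ℝ).comp_left (g := fun A : (Fin N → ℝ) →L[ℝ] ℝ => A (Pi.single i 1)) (by simp)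

/-- Integration of `g` against the truncated kernel in the direction of the `i`-th coordinate. -/
def dirFrac (a : ℝ) (i : Fin N) (g : (Fin N → ℝ) → ℝ) (x : Fin N → ℝ) : ℝ :=
  lineFrac a (fun t => g (Function.update x i t)) (x i)

lemma dirFrac_update (a : ℝ) (i : Fin N) (g : (Fin N → ℝ) → ℝ) (x : Fin N → ℝ) (t : ℝ) :
    dirFrac a i g (Function.update x i t) = lineFrac a (fun t => g (Function.update x i t)) t := by
  simp [dirFrac]

lemma abs_lineFrac_le {a : ℝ} (ha : 0 < a) {g : ℝ → ℝ} {C y : ℝ}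
    (hC : ∀ t ∈ Ioc y (y + 1), |g t| ≤ C) : |lineFrac a g y| ≤ (∫ r, fracKernel a r) * C := by
  rw [← integral_mul_const]
  refine norm_integral_le_of_norm_le (f := fun r => fracKernel a r * g (y + r))
    ((integrable_fracKernel ha).mul_const C) (ae_of_all _ fun r => ?_)
  rw [norm_mul, Real.norm_of_nonneg (fracKernel_nonneg _ _)]
  by_cases hr : r ∈ Ioc (0 : ℝ) 1
  · exact mul_le_mul_of_nonneg_left (hC _ ⟨by linarith [hr.1], by linarith [hr.2]⟩)
      (fracKernel_nonneg _ _)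
  · simp [fracKernel, hr]

lemma continuous_dirFrac {a : ℝ} (ha : 0 < a) (i : Fin N) {g : (Fin N → ℝ) → ℝ}
    (hg : Continuous g) {C : ℝ} (hC : ∀ x, |g x| ≤ C) : Continuous (dirFrac a i g) := by
  unfold dirFrac lineFrac
  refine continuous_of_dominated (bound := fun r => fracKernel a r * C) (fun x => ?_)
    (fun x => ae_of_all _ fun r => ?_) ((integrable_fracKernel ha).mul_const C)
    (ae_of_all _ fun r => ?_)
  · exact (integrable_kernel_mul (integrable_fracKernel ha)
      (hg.comp (continuous_const.update i continuous_id)) (fun t => hC _) (x i)).aestronglyMeasurable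
  · rw [norm_mul, Real.norm_of_nonneg (fracKernel_nonneg _ _)]
    exact mul_le_mul_of_nonneg_left (hC _) (fracKernel_nonneg _ _)
  · exact continuous_const.mul (hg.comp
      (continuous_id.update i ((continuous_apply i).add continuous_const)))

lemma rlPartialRight_eq {s : ℝ} (hs : s < 1) (i : Fin N) {w : (Fin N → ℝ) → ℝ}
    (hw : ContDiff ℝ 1 w) (hc : HasCompactSupport w) (h0 : ∀ x, 1 ≤ x i → w x = 0)
    {x : Fin N → ℝ} (hx : x ∈ cube N) :
    rlPartialRight s i w x
      = -(1 / Real.Gamma (1 - s)) * dirFrac (1 - s) i (partialDeriv i w) x := by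
  obtain ⟨C, hC⟩ := exists_bound_of_hasCompactSupport hw.continuous hc
  obtain ⟨C', hC'⟩ := exists_bound_of_hasCompactSupport (continuous_partialDeriv hw i)
    (hasCompactSupport_partialDeriv hc i)
  exact rlDerivRight_eq hs (fun t => hasDerivAt_update_line (hw.differentiable one_ne_zero) i x t)
    ((continuous_partialDeriv hw i).comp (continuous_const.update i continuous_id))
    (fun t => hC _) (fun t => hC' _) (fun t ht => h0 _ (by simpa using ht)) (hx i (mem_univ i))

/-- The integral is a convolution in one real variable with `x` as a parameter, evaluated at `0`.
All derivatives fall on the smooth factor, so the kernel need only be locally integrable. -/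
lemma contDiff_dirFrac {a : ℝ} (ha : 0 < a) (i : Fin N) {f : (Fin N → ℝ) → ℝ}
    (hf : ContDiff ℝ ∞ f) (hsupp : ∀ x, f x ≠ 0 → x i ∈ Icc (0 : ℝ) 1) :
    ContDiff ℝ ∞ (dirFrac a i f) := by
  rw [contDiff_iff_contDiffAt]
  intro x₀
  obtain ⟨R, hR⟩ : ∃ R, ‖x₀‖ < R := exists_gt _
  have hconv := contDiffOn_convolution_right_with_param_comp (n := ⊤) (μ := (volume : Measure ℝ))
    -- The integrand requires `xᵢ - y ∈ [0,1]`, so for `|xᵢ| < R` the compact set `[-R-1, R]` of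
    -- values `y` serves all `x` in the ball.
    (ContinuousLinearMap.mul ℝ ℝ) (s := Metric.ball (0 : Fin N → ℝ) R) (v := fun _ => (0 : ℝ))
    contDiffOn_const (f := fracKernel a) (g := fun x y => f (Function.update x i (x i - y)))
    (k := Icc (-R - 1) R) Metric.isOpen_ball isCompact_Icc ?_
    (integrable_fracKernel ha).locallyIntegrable ?_
  · refine (hconv.contDiffAt (Metric.isOpen_ball.mem_nhds (by simpa using hR))).congr_of_eventuallyEq
      (Eventually.of_forall fun x => ?_)
    simp [convolution, dirFrac, lineFrac]
  · intro x y hx hy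
    by_contra h
    have h1 := hsupp _ h
    have h2 : |x i| < R := lt_of_le_of_lt (norm_le_pi_norm x i) (by simpa using hx)
    have h3 := abs_lt.1 h2
    simp only [Function.update_self] at h1
    exact hy ⟨by linarith [h1.2], by linarith [h1.1]⟩
  · refine ContDiff.contDiffOn ?_
    have : (↿fun (x : Fin N → ℝ) y => f (Function.update x i (x i - y)))
        = fun q : (Fin N → ℝ) × ℝ => f (q.1 + (-q.2) • Pi.single i (1 : ℝ)) := by
      ext q
      simp [Function.HasUncurry.uncurry, update_eq_add]
    rw [this]
    exact hf.comp (contDiff_fst.add (contDiff_snd.neg.smul contDiff_const))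

lemma partialDeriv_dirFrac {a : ℝ} (ha : 0 < a) (i : Fin N) {f : (Fin N → ℝ) → ℝ}
    (hf : ContDiff ℝ ∞ f) (hc : HasCompactSupport f)
    (hsupp : ∀ x, f x ≠ 0 → x i ∈ Icc (0 : ℝ) 1) :
    partialDeriv i (dirFrac a i f) = dirFrac a i (partialDeriv i f) := by
  have hf1 : ContDiff ℝ 1 f := hf.of_le (by exact_mod_cast le_top)
  obtain ⟨C, hC⟩ := exists_bound_of_hasCompactSupport hf.continuous hc
  obtain ⟨C', hC'⟩ := exists_bound_of_hasCompactSupport (continuous_partialDeriv hf1 i)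
    (hasCompactSupport_partialDeriv hc i)
  ext x
  have h1 := hasDerivAt_update_line
    ((contDiff_dirFrac ha i hf hsupp).differentiable (by simp)) i x (x i)
  have h2 := hasDerivAt_integral_kernel (integrable_fracKernel ha)
    (fun t => hasDerivAt_update_line (hf1.differentiable one_ne_zero) i x t)
    ((continuous_partialDeriv hf1 i).comp (continuous_const.update i continuous_id))
    (fun t => hC _) (fun t => hC' _) (x i)
  simp only [dirFrac_update, Function.update_eq_self] at h1
  exact h1.unique h2

/-- The fractional integral commutes with the partial derivative, which reduces the identity to
Abel's inversion on each line. -/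
lemma dirFrac_partialDeriv_dirFrac {s : ℝ} (hs : s ∈ Ioo (0 : ℝ) 1) (i : Fin N)
    {f : (Fin N → ℝ) → ℝ} (hf : ContDiff ℝ ∞ f) (hc : HasCompactSupport f)
    (hsupp : ∀ x, f x ≠ 0 → x i ∈ Ioo (0 : ℝ) 1) {x : Fin N → ℝ} (hx : 0 ≤ x i) :
    dirFrac (1 - s) i (partialDeriv i (dirFrac s i f)) x = -abelConst s * f x := by
  have hf1 : ContDiff ℝ 1 f := hf.of_le (by exact_mod_cast le_top)
  obtain ⟨C', hC'⟩ := exists_bound_of_hasCompactSupport (continuous_partialDeriv hf1 i)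
    (hasCompactSupport_partialDeriv hc i)
  rw [partialDeriv_dirFrac hs.1 i hf hc (fun x h => Ioo_subset_Icc_self (hsupp x h)), dirFrac]
  simp only [dirFrac_update]
  have h := abel_inversion hs (fun t => hasDerivAt_update_line (hf1.differentiable one_ne_zero) i x t)
    ((continuous_partialDeriv hf1 i).comp (continuous_const.update i continuous_id))
    (fun t => hC' _) (fun t ht => ?_) hx
  · simpa using h
  · by_contra h
    have := (hsupp _ h).2
    simp only [Function.update_self] at this
    linarith

/-! ### The cutoff near a face and its error -/

lemma integrable_fracKernel_mul {a : ℝ} (ha : 0 < a) {g : ℝ → ℝ} (hg : Continuous g) (y : ℝ) :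
    Integrable fun r => fracKernel a r * g (y + r) := by
  have h : IntegrableOn (fun r => fracKernel a r * g (y + r)) (Icc 0 1) :=
    (integrable_fracKernel ha).integrableOn.mul_continuousOn
      (hg.comp (by fun_prop)).continuousOn isCompact_Icc
  refine (integrableOn_iff_integrable_of_support_subset fun r hr => ?_).1 h
  by_contra hr'
  have : r ∉ Ioc (0 : ℝ) 1 := fun h => hr' (Ioc_subset_Icc_self h)
  simp [fracKernel, this] at hr

lemma lineFrac_sub {a : ℝ} (ha : 0 < a) {g h : ℝ → ℝ} (hg : Continuous g) (hh : Continuous h)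
    (y : ℝ) : lineFrac a (fun t => g t - h t) y = lineFrac a g y - lineFrac a h y := by
  simp only [lineFrac, mul_sub]
  exact integral_sub (integrable_fracKernel_mul ha hg y) (integrable_fracKernel_mul ha hh y)

lemma lineFrac_const_mul (a c : ℝ) (g : ℝ → ℝ) (y : ℝ) :
    lineFrac a (fun t => c * g t) y = c * lineFrac a g y := by
  simp only [lineFrac, ← integral_const_mul]
  congr 1 with r
  ring

/-- The smooth cutoff that vanishes on `(-∞, ε]` and equals `1` on `[2 ε, ∞)`. -/
def cutoff (ε t : ℝ) : ℝ := Real.smoothTransition (t / ε - 1)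

lemma contDiff_cutoff (ε : ℝ) : ContDiff ℝ ∞ (cutoff ε) :=
  Real.smoothTransition.contDiff.comp ((contDiff_id.div_const ε).sub contDiff_const)

lemma cutoff_eq_zero {ε t : ℝ} (hε : 0 < ε) (ht : t ≤ ε) : cutoff ε t = 0 :=
  Real.smoothTransition.zero_of_nonpos (by rw [sub_nonpos, div_le_one hε]; exact ht)

lemma cutoff_eq_one {ε t : ℝ} (hε : 0 < ε) (ht : 2 * ε ≤ t) : cutoff ε t = 1 :=
  Real.smoothTransition.one_of_one_le (by
    rw [le_sub_iff_add_le, le_div_iff₀ hε]; linarith)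

lemma cutoff_nonneg (ε t : ℝ) : 0 ≤ cutoff ε t := Real.smoothTransition.nonneg _

lemma cutoff_le_one (ε t : ℝ) : cutoff ε t ≤ 1 := Real.smoothTransition.le_one _

/-- All the cutoffs are rescalings of one profile, whose derivative is bounded on `[-1,1]`. -/
lemma exists_bound_deriv_cutoff :
    ∃ M, 0 ≤ M ∧ ∀ ε t, 0 < ε → t ∈ Icc 0 (2 * ε) → |deriv (cutoff ε) t| ≤ M / ε := by
  have hc : Continuous (deriv Real.smoothTransition) :=
    (Real.smoothTransition.contDiff (n := 1)).continuous_deriv le_rfl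
  obtain ⟨M, hM⟩ := (isCompact_Icc (a := (-1 : ℝ)) (b := 1)).exists_bound_of_continuousOn
    hc.continuousOn
  refine ⟨M, (norm_nonneg _).trans (hM 0 (by simp)), fun ε t hε ht => ?_⟩
  have hd : HasDerivAt (cutoff ε) (deriv Real.smoothTransition (t / ε - 1) * (1 / ε)) t :=
    HasDerivAt.comp (h₂ := Real.smoothTransition) (h := fun t => t / ε - 1) t
      (((Real.smoothTransition.contDiff (n := 1)).differentiable one_ne_zero _).hasDerivAt)
      (((hasDerivAt_id t).div_const ε).sub_const 1)
  rw [hd.deriv, abs_mul, abs_of_pos (one_div_pos.2 hε), mul_one_div]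
  refine div_le_div_of_nonneg_right (hM _ ⟨?_, ?_⟩) hε.le
  · have := div_nonneg ht.1 hε.le
    linarith
  · have : t / ε ≤ 2 := (div_le_iff₀ hε).2 ht.2
    linarith

lemma abs_le_mul_of_deriv_le {V V' : ℝ → ℝ} (hV : ∀ t, HasDerivAt V (V' t) t) (h0 : V 0 = 0)
    {L : ℝ} (hL : ∀ t ∈ Icc (0 : ℝ) 1, |V' t| ≤ L) {t : ℝ} (ht : t ∈ Icc (0 : ℝ) 1) :
    |V t| ≤ L * t := by
  have := (convex_Icc (0 : ℝ) 1).norm_image_sub_le_of_norm_hasDerivWithin_le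
    (fun t _ => (hV t).hasDerivWithinAt) hL (left_mem_Icc.2 zero_le_one) ht
  simpa [h0, abs_of_nonneg ht.1] using this

/-- In the derivative `-χ' V + (1 - χ) V'` the factor `|χ'| ≤ M/ε` is compensated by `|V| ≤ 2 L ε`,
so it is at most `(2M+1) L` whatever `ε` is. It vanishes beyond `2ε`, so for `y > 0` only `r ≤ 2ε`
contributes to the integral. -/
lemma exists_cutoff_error_bound {a : ℝ} (ha : 0 < a) : ∃ M, ∀ {V V' : ℝ → ℝ} {L ε y : ℝ},
    (∀ t, HasDerivAt V (V' t) t) → V 0 = 0 → (∀ t ∈ Icc (0 : ℝ) 1, |V' t| ≤ L) →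
    0 < ε → 2 * ε ≤ 1 → 0 < y →
    |lineFrac a (deriv fun t => (1 - cutoff ε t) * V t) y|
      ≤ M * L * ∫ r in (0 : ℝ)..(2 * ε), fracKernel a r := by
  obtain ⟨M, hM0, hM⟩ := exists_bound_deriv_cutoff
  refine ⟨2 * M + 1, fun {V V' L ε y} hV h0 hL hε hε1 hy => ?_⟩
  have hL0 : 0 ≤ L := (abs_nonneg _).trans (hL 0 (by simp))
  have hd : ∀ t, HasDerivAt (fun t => (1 - cutoff ε t) * V t)
      (-deriv (cutoff ε) t * V t + (1 - cutoff ε t) * V' t) t := fun t =>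
    ((((contDiff_cutoff ε).differentiable (by simp) t).hasDerivAt).const_sub 1).mul (hV t)
  have hsmall : ∀ t ∈ Icc 0 (2 * ε), |deriv (fun t => (1 - cutoff ε t) * V t) t|
      ≤ (2 * M + 1) * L := by
    intro t ht
    have ht1 : t ∈ Icc (0 : ℝ) 1 := ⟨ht.1, ht.2.trans hε1⟩
    rw [(hd t).deriv]
    refine (abs_add_le _ _).trans ?_
    rw [abs_mul, abs_mul, abs_neg, abs_of_nonneg (sub_nonneg.2 (cutoff_le_one ε t))]
    have h1 : |deriv (cutoff ε) t| * |V t| ≤ (M / ε) * (L * (2 * ε)) :=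
      mul_le_mul (hM ε t hε ht) ((abs_le_mul_of_deriv_le hV h0 hL ht1).trans
        (mul_le_mul_of_nonneg_left ht.2 hL0)) (abs_nonneg _) (div_nonneg hM0 hε.le)
    have h2 : (1 - cutoff ε t) * |V' t| ≤ 1 * L :=
      mul_le_mul (by linarith [cutoff_nonneg ε t]) (hL t ht1) (abs_nonneg _) zero_le_one
    have h3 : (M / ε) * (L * (2 * ε)) = 2 * M * L := by field_simp
    linarith
  have hlarge : ∀ t, 2 * ε < t → deriv (fun t => (1 - cutoff ε t) * V t) t = 0 := by
    intro t ht
    have : (fun t => (1 - cutoff ε t) * V t) =ᶠ[𝓝 t] fun _ => 0 := by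
      filter_upwards [lt_mem_nhds ht] with z hz
      simp [cutoff_eq_one hε hz.le]
    rw [this.deriv_eq, deriv_const]
  rw [intervalIntegral.integral_of_le (by linarith), ← integral_indicator measurableSet_Ioc,
    ← integral_const_mul]
  refine norm_integral_le_of_norm_le
    (f := fun r => fracKernel a r * deriv (fun t => (1 - cutoff ε t) * V t) (y + r))
    (((integrable_fracKernel ha).indicator measurableSet_Ioc).const_mul _)
    (ae_of_all _ fun r => ?_)
  rw [norm_mul, Real.norm_of_nonneg (fracKernel_nonneg _ _), Real.norm_eq_abs]
  by_cases hr0 : 0 < r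
  · by_cases hr : r ≤ 2 * ε
    · rw [indicator_of_mem (show r ∈ Ioc 0 (2 * ε) from ⟨hr0, hr⟩), mul_comm]
      refine mul_le_mul_of_nonneg_right ?_ (fracKernel_nonneg _ _)
      by_cases h : y + r ≤ 2 * ε
      · exact hsmall _ ⟨by linarith, h⟩
      · rw [hlarge _ (not_le.1 h), abs_zero]
        positivity
    · rw [hlarge _ (by linarith), abs_zero, mul_zero,
        indicator_of_notMem fun h => hr h.2, mul_zero]
  · have : r ∉ Ioc (0 : ℝ) 1 := fun h => hr0 h.1
    rw [indicator_of_notMem fun h => hr0 h.1]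
    simp [fracKernel, this]

lemma tendsto_integral_fracKernel {a : ℝ} (ha : 0 < a) :
    Tendsto (fun ε => ∫ r in (0 : ℝ)..(2 * ε), fracKernel a r) (𝓝[>] 0) (𝓝 0) := by
  have hc := intervalIntegral.continuous_primitive
    (fun a' b' => (integrable_fracKernel ha).intervalIntegrable (a := a') (b := b')) 0
  have h2 : Tendsto (fun ε => ∫ r in (0 : ℝ)..(2 * ε), fracKernel a r) (𝓝 0)
      (𝓝 (∫ r in (0 : ℝ)..(2 * 0), fracKernel a r)) :=
    (hc.comp (by fun_prop : Continuous fun ε : ℝ => 2 * ε)).tendsto 0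
  rw [mul_zero, intervalIntegral.integral_same] at h2
  exact h2.mono_left nhdsWithin_le_nhds

/-! ### Testing the variation with one-component fields -/

/-- The normalizing constant of the fractional divergence. -/
def divConst (N : ℕ) (s : ℝ) : ℝ := (1 - 1 / (N : ℝ)) * s + 1 / (N : ℝ)

lemma divConst_pos (hN : 1 ≤ N) {s : ℝ} (hs : 0 < s) : 0 < divConst N s := by
  have h1 : (1 : ℝ) ≤ N := by exact_mod_cast hN
  have h2 : 1 / (N : ℝ) ≤ 1 := by rw [div_le_one (by linarith)]; exact h1
  have h3 : 0 < 1 / (N : ℝ) := by positivity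
  have : 0 ≤ (1 - 1 / (N : ℝ)) * s := mul_nonneg (by linarith) hs.le
  unfold divConst
  linarith

lemma abs_apply_le_norm_toLp {p : ℝ≥0∞} (hp : 1 ≤ p) (x : Fin N → ℝ) (i : Fin N) :
    |x i| ≤ ‖WithLp.toLp p x‖ := by
  have : Fact (1 ≤ p) := ⟨hp⟩
  exact PiLp.norm_apply_le (WithLp.toLp p x) i

lemma dualNorm_single_le {p : ℝ≥0∞} (hp : 1 ≤ p) (i : Fin N) (c : ℝ) :
    dualNorm p (Pi.single i c) ≤ |c| := by
  refine Real.sSup_le ?_ (abs_nonneg c)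
  rintro t ⟨x, hx, rfl⟩
  rw [Finset.sum_eq_single i (fun j _ hj => by simp [hj]) (by simp)]
  simp only [Pi.single_eq_same]
  refine (le_abs_self _).trans ?_
  rw [abs_mul]
  exact mul_le_of_le_one_left (abs_nonneg _) ((abs_apply_le_norm_toLp hp x i).trans hx)

lemma rlPartialRight_const_mul (s c : ℝ) (i : Fin N) (w : (Fin N → ℝ) → ℝ) (x : Fin N → ℝ) :
    rlPartialRight s i (fun y => c * w y) x = c * rlPartialRight s i w x := by
  simp only [rlPartialRight, rlDerivRight, mul_div_assoc, intervalIntegral.integral_const_mul]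
  rw [deriv_const_mul_field]
  ring

lemma rlPartialRight_zero (s : ℝ) (i : Fin N) (x : Fin N → ℝ) :
    rlPartialRight s i (fun _ => 0) x = 0 := by
  simp [rlPartialRight, rlDerivRight]

lemma fracDiv_single (s : ℝ) (i : Fin N) (w : (Fin N → ℝ) → ℝ) (x : Fin N → ℝ) :
    fracDiv s (fun y => Pi.single i (w y)) x = divConst N s * rlPartialRight s i w x := by
  rw [fracDiv, divConst, Finset.sum_eq_single i (fun j _ hj => ?_) (by simp)]
  · simp
  · simp [hj, rlPartialRight_zero]

lemma measurableSet_cube : MeasurableSet (cube N) :=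
  MeasurableSet.univ_pi fun _ => measurableSet_Ioo

lemma isOpen_cube : IsOpen (cube N) :=
  isOpen_set_pi finite_univ fun _ _ => isOpen_Ioo

lemma integral_mul_fracDiv_le {s : ℝ} {p : ℝ≥0∞} {u : (Fin N → ℝ) → ℝ}
    (hu : fracTV s p u < ⊤) {φ : (Fin N → ℝ) → (Fin N → ℝ)} (hφ : IsTestField p φ) :
    ∫ x in cube N, u x * fracDiv s φ x ≤ (fracTV s p u).toReal := by
  rw [← ENNReal.ofReal_le_iff_le_toReal hu.ne]
  exact le_iSup₂ (f := fun φ (_ : IsTestField p φ) =>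
    ENNReal.ofReal (∫ x in cube N, u x * fracDiv s φ x)) φ hφ

/-- A field whose only nonzero component is a multiple of `w` is admissible for every exponent after
division by `b`. -/
lemma abs_integral_mul_dirFrac_le (hN : 1 ≤ N) {s : ℝ} (hs : s ∈ Ioo (0 : ℝ) 1) {p : ℝ≥0∞}
    (hp : 1 ≤ p) {u : (Fin N → ℝ) → ℝ} (hu : fracTV s p u < ⊤) (i : Fin N)
    {w : (Fin N → ℝ) → ℝ} (hw : ContDiff ℝ ∞ w) (hc : HasCompactSupport w)
    (hsub : tsupport w ⊆ cube N) {b : ℝ} (hb : 0 < b) (hwb : ∀ x, |w x| ≤ b) :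
    |∫ x in cube N, u x * dirFrac (1 - s) i (partialDeriv i w) x|
      ≤ Real.Gamma (1 - s) / divConst N s * b * (fracTV s p u).toReal := by
  have hΓ : 0 < Real.Gamma (1 - s) := Real.Gamma_pos_of_pos (by linarith [hs.2])
  have hd := divConst_pos hN hs.1
  have h0 : ∀ x, 1 ≤ x i → w x = 0 := by
    intro x hx
    by_contra h
    have := (hsub (subset_tsupport _ h) i (mem_univ i)).2
    linarith
  have main : ∀ σ : ℝ, |σ| = 1 →
      σ * ∫ x in cube N, u x * dirFrac (1 - s) i (partialDeriv i w) x
        ≤ Real.Gamma (1 - s) / divConst N s * b * (fracTV s p u).toReal := by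
    intro σ hσ
    -- The minus sign cancels the one in the Riemann–Liouville derivative; `σ = ±1` produces the
    -- absolute value.
    have htest : IsTestField p fun x => (Pi.single i ((-σ * b⁻¹) * w x) : Fin N → ℝ) := by
      have hts := tsupport_comp_subset
        (g := fun t : ℝ => (Pi.single i ((-σ * b⁻¹) * t) : Fin N → ℝ)) (by simp) w
      refine ⟨?_, ?_, ?_, fun x => ?_⟩
      · exact (ContinuousLinearMap.single ℝ (fun _ : Fin N => ℝ) i).contDiff.comp
          (contDiff_const.mul hw)
      · exact hc.comp_left (g := fun t : ℝ => (Pi.single i ((-σ * b⁻¹) * t) : Fin N → ℝ)) (by simp)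
      · exact hts.trans hsub
      · refine (dualNorm_single_le hp i _).trans ?_
        rw [abs_mul, abs_mul, abs_neg, hσ, one_mul, abs_of_pos (inv_pos.2 hb), inv_mul_le_iff₀ hb,
          mul_one]
        exact hwb x
    have h := integral_mul_fracDiv_le hu htest
    have e : ∫ x in cube N, u x * fracDiv s
          (fun x => (Pi.single i ((-σ * b⁻¹) * w x) : Fin N → ℝ)) x
        = (divConst N s / Real.Gamma (1 - s) / b) *
          (σ * ∫ x in cube N, u x * dirFrac (1 - s) i (partialDeriv i w) x) := by
      rw [← integral_const_mul, ← integral_const_mul]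
      refine setIntegral_congr_fun measurableSet_cube fun x hx => ?_
      rw [fracDiv_single, rlPartialRight_const_mul,
        rlPartialRight_eq hs.2 i (hw.of_le (by exact_mod_cast le_top)) hc h0 hx]
      field_simp
    rw [e] at h
    have hpos : 0 < divConst N s / Real.Gamma (1 - s) / b := by positivity
    rw [← le_div_iff₀' hpos] at h
    refine h.trans (le_of_eq ?_)
    field_simp
  refine abs_le.2 ⟨?_, ?_⟩
  · have := main (-1) (by simp)
    linarith
  · have := main 1 (by simp)
    linarith

/-! ### The corrected primitive and the key estimate -/

/-- The support of `f` lies in the closed box `[α, 1-α]^N`. -/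
def BoxSupported (α : ℝ) (f : (Fin N → ℝ) → ℝ) : Prop :=
  ∀ x, f x ≠ 0 → ∀ j, x j ∈ Icc α (1 - α)

lemma BoxSupported.tsupport_subset {α : ℝ} {f : (Fin N → ℝ) → ℝ} (h : BoxSupported α f) :
    tsupport f ⊆ univ.pi fun _ => Icc α (1 - α) :=
  closure_minimal (fun x hx j _ => h x hx j) (isClosed_set_pi fun _ _ => isClosed_Icc)

lemma BoxSupported.hasCompactSupport {α : ℝ} {f : (Fin N → ℝ) → ℝ} (h : BoxSupported α f) :
    HasCompactSupport f :=
  (isCompact_univ_pi fun _ => isCompact_Icc).of_isClosed_subset (isClosed_tsupport f)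
    h.tsupport_subset

lemma BoxSupported.tsupport_subset_cube {α : ℝ} {f : (Fin N → ℝ) → ℝ} (h : BoxSupported α f)
    (hα : 0 < α) : tsupport f ⊆ cube N := fun _ hx j hj =>
  Icc_subset_Ioo hα (by linarith) (h.tsupport_subset hx j hj)

lemma exists_boxSupported {f : (Fin N → ℝ) → ℝ} (hc : HasCompactSupport f)
    (hsub : tsupport f ⊆ cube N) : ∃ α, 0 < α ∧ α ≤ 1 / 2 ∧ BoxSupported α f := by
  have key : ∀ j : Fin N, ∃ α : ℝ, 0 < α ∧ ∀ x ∈ tsupport f, x j ∈ Icc α (1 - α) := by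
    intro j
    rcases (tsupport f).eq_empty_or_nonempty with h | h
    · exact ⟨1, one_pos, by simp [h]⟩
    obtain ⟨x, hx, hxm⟩ := IsCompact.exists_isMinOn hc.isCompact h
      (continuous_apply j).continuousOn
    obtain ⟨y, hy, hym⟩ := IsCompact.exists_isMaxOn hc.isCompact h
      (continuous_apply j).continuousOn
    refine ⟨min (x j) (1 - y j), lt_min (hsub hx j (mem_univ j)).1
      (by linarith [(hsub hy j (mem_univ j)).2]), fun z hz => ⟨?_, ?_⟩⟩
    · exact (min_le_left _ _).trans (hxm hz)
    · have h1 : z j ≤ y j := hym hz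
      linarith [min_le_right (x j) (1 - y j)]
  choose α hα hα' using key
  obtain ⟨β, hβ, hβ'⟩ : ∃ β : ℝ, 0 < β ∧ ∀ j, β ≤ α j := by
    rcases isEmpty_or_nonempty (Fin N) with h | h
    · exact ⟨1, one_pos, fun j => h.elim j⟩
    · obtain ⟨j, hj⟩ := Finite.exists_min α
      exact ⟨α j, hα j, hj⟩
  -- The cap `1/2` ensures that `cutoff (1 / 4)` equals one beyond `1 - α`, so that the face
  -- correction does not enlarge the support to the right.
  refine ⟨min β (1 / 2), lt_min hβ (by norm_num), min_le_right _ _, fun x hx j => ?_⟩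
  have h := hα' j x (subset_tsupport f hx)
  have h1 := (min_le_left β (1 / 2)).trans (hβ' j)
  exact ⟨h1.trans h.1, h.2.trans (by linarith)⟩

/-- `dirFrac s i f`, corrected so that it vanishes on the face `x i = 0`. -/
def correctedFrac (s : ℝ) (i : Fin N) (f : (Fin N → ℝ) → ℝ) (x : Fin N → ℝ) : ℝ :=
  dirFrac s i f x - dirFrac s i f (Function.update x i 0) * (1 - cutoff (1 / 4) (x i))

lemma contDiff_update_zero (i : Fin N) : ContDiff ℝ ∞ fun x : Fin N → ℝ => Function.update x i 0 := by
  simp only [update_eq_add]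
  exact contDiff_id.add ((contDiff_const.sub (contDiff_apply ℝ ℝ i)).smul contDiff_const)

section KeyEstimate

variable {s α : ℝ} {i : Fin N} {f : (Fin N → ℝ) → ℝ}

lemma contDiff_correctedFrac (hs : 0 < s) (hf : ContDiff ℝ ∞ f) (hα : 0 < α)
    (hb : BoxSupported α f) : ContDiff ℝ ∞ (correctedFrac s i f) := by
  have hW : ContDiff ℝ ∞ (dirFrac s i f) := contDiff_dirFrac hs i hf fun x hx =>
    Icc_subset_Icc hα.le (by linarith) (hb x hx i)
  exact hW.sub ((hW.comp (contDiff_update_zero i)).mul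
    (contDiff_const.sub ((contDiff_cutoff _).comp (contDiff_apply ℝ ℝ i))))

/-- Integration runs to the right, so the support can spread only towards smaller `xᵢ`. -/
lemma dirFrac_support (hb : BoxSupported α f) {x : Fin N → ℝ} (hx : dirFrac s i f x ≠ 0) :
    (∀ j, j ≠ i → x j ∈ Icc α (1 - α)) ∧ x i ≤ 1 - α := by
  obtain ⟨r, hr⟩ : ∃ r, fracKernel s r * f (Function.update x i (x i + r)) ≠ 0 := by
    by_contra! h
    exact hx (by simp [dirFrac, lineFrac, h])
  have hr0 : 0 < r := by
    by_contra h
    have : r ∉ Ioc (0 : ℝ) 1 := fun h' => h h'.1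
    exact hr (by simp [fracKernel, this])
  have h := hb _ (right_ne_zero_of_mul hr)
  refine ⟨fun j hj => by simpa [hj] using h j, ?_⟩
  have := (h i).2
  simp only [Function.update_self] at this
  linarith

lemma correctedFrac_support (hα : α ≤ 1 / 2) (hb : BoxSupported α f) {x : Fin N → ℝ}
    (hx : correctedFrac s i f x ≠ 0) :
    (∀ j, j ≠ i → x j ∈ Icc α (1 - α)) ∧ x i ≤ 1 - α := by
  by_cases h1 : dirFrac s i f x = 0
  · rw [correctedFrac, h1, zero_sub, neg_ne_zero] at hx
    have h2 := (dirFrac_support hb (left_ne_zero_of_mul hx)).1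
    refine ⟨fun j hj => by simpa [hj] using h2 j hj, ?_⟩
    by_contra h3
    rw [cutoff_eq_one (by norm_num) (by linarith)] at hx
    simp at hx
  · exact dirFrac_support hb h1

lemma correctedFrac_update_zero (x : Fin N → ℝ) :
    correctedFrac s i f (Function.update x i 0) = 0 := by
  rw [correctedFrac, Function.update_idem, Function.update_self,
    cutoff_eq_zero (by norm_num) (by norm_num), sub_zero, mul_one, sub_self]

lemma abs_correctedFrac_le {δ : ℝ} (hδ : ∀ x, |dirFrac s i f x| ≤ δ) (x : Fin N → ℝ) :
    |correctedFrac s i f x| ≤ 2 * δ := by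
  refine (abs_sub _ _).trans ?_
  have h1 : |1 - cutoff (1 / 4) (x i)| ≤ 1 := by
    rw [abs_le]
    constructor <;> linarith [cutoff_nonneg (1 / 4) (x i), cutoff_le_one (1 / 4) (x i)]
  rw [abs_mul]
  have := mul_le_mul (hδ (Function.update x i 0)) h1 (abs_nonneg _)
    ((abs_nonneg _).trans (hδ (Function.update x i 0)))
  linarith [hδ x]

/-- The face `xᵢ = 0` is the only one that the support of the corrected primitive may reach, and the
cutoff removes it. -/
lemma boxSupported_cutoff_mul {ε : ℝ} (hε : 0 < ε) (hα : α ≤ 1 / 2)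
    (hb : BoxSupported α f) :
    BoxSupported (min ε α) fun x => cutoff ε (x i) * correctedFrac s i f x := by
  intro x hx j
  have h := correctedFrac_support hα hb (right_ne_zero_of_mul hx)
  have hm := min_le_right ε α
  by_cases hj : j = i
  · subst hj
    refine ⟨?_, by linarith⟩
    by_contra h'
    exact left_ne_zero_of_mul hx
      (cutoff_eq_zero hε ((not_le.1 h').le.trans (min_le_left _ _)))
  · have := h.1 j hj
    exact ⟨hm.trans this.1, by linarith [this.2]⟩

/-- The fractional derivative of the cut-off corrected primitive is `f` up to controlled errors. -/
lemma dirFrac_partialDeriv_cutoff_mul (hs : s ∈ Ioo (0 : ℝ) 1) (hf : ContDiff ℝ ∞ f) (hα : 0 < α)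
    (hb : BoxSupported α f) (ε : ℝ) {x : Fin N → ℝ} (hx : 0 ≤ x i) :
    dirFrac (1 - s) i (partialDeriv i fun x => cutoff ε (x i) * correctedFrac s i f x) x
      = -abelConst s * f x
        + dirFrac s i f (Function.update x i 0)
            * lineFrac (1 - s) (deriv (cutoff (1 / 4))) (x i)
        - lineFrac (1 - s) (deriv fun t => (1 - cutoff ε t) *
            correctedFrac s i f (Function.update x i t)) (x i) := by
  have h1s : 0 < 1 - s := by linarith [hs.2]
  have hI : ∀ x, f x ≠ 0 → x i ∈ Ioo (0 : ℝ) 1 := fun x hx =>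
    Icc_subset_Ioo hα (by linarith) (hb x hx i)
  have hW : ContDiff ℝ ∞ (dirFrac s i f) := contDiff_dirFrac hs.1 i hf fun x hx =>
    Ioo_subset_Icc_self (hI x hx)
  have hV := contDiff_correctedFrac (i := i) hs.1 hf hα hb
  have hw : ContDiff ℝ ∞ fun x : Fin N → ℝ => cutoff ε (x i) * correctedFrac s i f x :=
    ((contDiff_cutoff ε).comp (contDiff_apply ℝ ℝ i)).mul hV
  have hcut : ∀ ε t, HasDerivAt (cutoff ε) (deriv (cutoff ε) t) t := fun ε t =>
    ((contDiff_cutoff ε).differentiable (by simp) t).hasDerivAt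
  have hWl := fun t => hasDerivAt_update_line (hW.differentiable (by simp)) i x t
  have hwl := fun t => hasDerivAt_update_line (hw.differentiable (by simp)) i x t
  have hline : ContDiff ℝ ∞ fun t => Function.update x i t := by
    simp only [update_eq_add]
    exact contDiff_const.add ((contDiff_id.sub contDiff_const).smul contDiff_const)
  have hr : ContDiff ℝ ∞ fun t => (1 - cutoff ε t) * correctedFrac s i f (Function.update x i t) :=
    (contDiff_const.sub (contDiff_cutoff ε)).mul (hV.comp hline)
  have hrl := fun t => (hr.differentiable (by simp) t).hasDerivAt
  -- With `W` the fractional integral, `W₀` its face value, `V` the corrected primitive and `χ` the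
  -- cutoffs, this differentiates `χ_ε V = W - W₀ (1 - χ_{1/4}) - (1 - χ_ε) V` along the line.
  have key : ∀ t, partialDeriv i (fun x => cutoff ε (x i) * correctedFrac s i f x)
      (Function.update x i t)
      = (partialDeriv i (dirFrac s i f) (Function.update x i t)
        - (-dirFrac s i f (Function.update x i 0)) * deriv (cutoff (1 / 4)) t)
        - deriv (fun t => (1 - cutoff ε t) * correctedFrac s i f (Function.update x i t)) t := by
    intro t
    have h := ((hWl t).sub (((hcut (1 / 4) t).const_sub 1).const_mul
      (dirFrac s i f (Function.update x i 0)))).sub (hrl t)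
    refine (hwl t).unique ?_
    convert h using 1
    · ext t
      simp only [correctedFrac, Function.update_self, Function.update_idem, Pi.sub_apply]
      ring
    · ring
  have c1 : Continuous fun t => partialDeriv i (dirFrac s i f) (Function.update x i t) :=
    (continuous_partialDeriv (hW.of_le (by exact_mod_cast le_top)) i).comp hline.continuous
  have c2 : Continuous fun t =>
      (-dirFrac s i f (Function.update x i 0)) * deriv (cutoff (1 / 4)) t :=
    continuous_const.mul ((contDiff_cutoff _).continuous_deriv (by simp))
  have c3 : Continuous
      (deriv fun t => (1 - cutoff ε t) * correctedFrac s i f (Function.update x i t)) :=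
    hr.continuous_deriv (by simp)
  have habel := dirFrac_partialDeriv_dirFrac hs i hf hb.hasCompactSupport hI hx
  rw [dirFrac] at habel ⊢
  simp only [key]
  have c12 : Continuous fun t => partialDeriv i (dirFrac s i f) (Function.update x i t) -
      (-dirFrac s i f (Function.update x i 0)) * deriv (cutoff (1 / 4)) t := c1.sub c2
  rw [lineFrac_sub h1s c12 c3, lineFrac_sub h1s c1 c2, lineFrac_const_mul, habel]
  ring

lemma exists_bound_lineFrac_deriv_cutoff (hs : s < 1) :
    ∃ C, 0 ≤ C ∧ ∀ y ∈ Icc (0 : ℝ) 1, |lineFrac (1 - s) (deriv (cutoff (1 / 4))) y| ≤ C := by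
  obtain ⟨C, hC⟩ := (isCompact_Icc (a := (0 : ℝ)) (b := 2)).exists_bound_of_continuousOn
    ((contDiff_cutoff (1 / 4)).continuous_deriv (by simp)).continuousOn
  have h : ∀ y ∈ Icc (0 : ℝ) 1, |lineFrac (1 - s) (deriv (cutoff (1 / 4))) y|
      ≤ (∫ r, fracKernel (1 - s) r) * C := fun y hy =>
    abs_lineFrac_le (by linarith) fun t ht => hC t ⟨by linarith [hy.1, ht.1], by
      linarith [hy.2, ht.2]⟩
  exact ⟨_, (abs_nonneg _).trans (h 0 (by simp)), h⟩

lemma abs_setIntegral_mul_le {u g : (Fin N → ℝ) → ℝ} (hu : IntegrableOn u (cube N)) {E : ℝ}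
    (hg : ∀ x ∈ cube N, |g x| ≤ E) :
    |∫ x in cube N, u x * g x| ≤ E * ∫ x in cube N, |u x| := by
  rw [← integral_const_mul]
  refine norm_integral_le_of_norm_le (f := fun x => u x * g x) (hu.abs.const_mul E) ?_
  filter_upwards [ae_restrict_mem measurableSet_cube] with x hx
  rw [norm_mul, mul_comm]
  exact mul_le_mul_of_nonneg_right (hg x hx) (norm_nonneg _)

/-- Functions of bounded fractional variation act continuously on test functions endowed with the
norm `sup |dirFrac s i f|`. -/
theorem exists_integral_mul_le (hN : 1 ≤ N) (hs : s ∈ Ioo (0 : ℝ) 1) :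
    ∃ A, 0 ≤ A ∧ ∀ {p : ℝ≥0∞} {u f : (Fin N → ℝ) → ℝ} {i : Fin N} {δ : ℝ}, 1 ≤ p →
      IntegrableOn u (cube N) → fracTV s p u < ⊤ → ContDiff ℝ ∞ f → HasCompactSupport f →
      tsupport f ⊆ cube N → (∀ x, |dirFrac s i f x| ≤ δ) →
      |∫ x in cube N, u x * f x|
        ≤ A * δ * ((∫ x in cube N, |u x|) + (fracTV s p u).toReal) := by
  have h1s : 0 < 1 - s := by linarith [hs.2]
  have hB := abelConst_pos hs
  have hΓ : 0 < Real.Gamma (1 - s) := Real.Gamma_pos_of_pos h1s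
  have hd := divConst_pos hN hs.1
  obtain ⟨C, hC0, hC⟩ := exists_bound_lineFrac_deriv_cutoff hs.2
  obtain ⟨M, hM⟩ := exists_cutoff_error_bound h1s
  -- The factor `2` is the loss in `abs_correctedFrac_le`.
  set D := Real.Gamma (1 - s) / divConst N s * 2 with hD
  have hD0 : 0 ≤ D := by positivity
  refine ⟨(D + C) / abelConst s, by positivity, ?_⟩
  intro p u f i δ hp hu hTV hf hfc hfs hδ
  obtain ⟨α, hα, hα2, hb⟩ := exists_boxSupported hfc hfs
  set T := (fracTV s p u).toReal
  set n := ∫ x in cube N, |u x|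
  have hn : 0 ≤ n := integral_nonneg fun _ => abs_nonneg _
  have hT : 0 ≤ T := ENNReal.toReal_nonneg
  have hV := contDiff_correctedFrac (i := i) hs.1 hf hα hb
  have hV1 : ContDiff ℝ 1 (correctedFrac s i f) := hV.of_le (by exact_mod_cast le_top)
  -- The bound `L` depends on `f` and is not controlled by `δ`; it occurs only in the error term
  -- that disappears as `ε → 0`.
  obtain ⟨L, hL⟩ := (isCompact_univ_pi fun _ : Fin N => isCompact_Icc (a := (0 : ℝ)) (b := 1)
    ).exists_bound_of_continuousOn (continuous_partialDeriv hV1 i).continuousOn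
  have hδ0 : 0 ≤ δ := (abs_nonneg _).trans (hδ 0)
  obtain ⟨Cf, hCf⟩ := exists_bound_of_hasCompactSupport hf.continuous hfc
  -- A number `δ' > δ` is strictly positive even if `δ = 0`, as the normalization of the test field
  -- requires.
  have step : ∀ δ', δ < δ' → ∀ ε, 0 < ε → 2 * ε ≤ 1 → abelConst s * |∫ x in cube N, u x * f x|
      ≤ D * δ' * T + (δ' * C + M * L * ∫ r in (0 : ℝ)..(2 * ε), fracKernel (1 - s) r) * n := by
    intro δ' hδ' ε hε hε1
    set w := fun x : Fin N → ℝ => cutoff ε (x i) * correctedFrac s i f x with hw_def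
    have hwb : BoxSupported (min ε α) w := boxSupported_cutoff_mul hε hα2 hb
    have hw : ContDiff ℝ ∞ w := ((contDiff_cutoff ε).comp (contDiff_apply ℝ ℝ i)).mul hV
    have hw1 : ContDiff ℝ 1 w := hw.of_le (by exact_mod_cast le_top)
    have hle : ∀ x, |w x| ≤ 2 * δ' := by
      intro x
      rw [hw_def, abs_mul, abs_of_nonneg (cutoff_nonneg _ _)]
      have := mul_le_mul (cutoff_le_one ε (x i)) (abs_correctedFrac_le hδ x) (abs_nonneg _)
        zero_le_one
      linarith
    have h1 := abs_integral_mul_dirFrac_le hN hs hp hTV i hw hwb.hasCompactSupport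
      (hwb.tsupport_subset_cube (lt_min hε hα)) (b := 2 * δ') (by linarith) hle
    obtain ⟨Cw, hCw⟩ := exists_bound_of_hasCompactSupport (continuous_partialDeriv hw1 i)
      (hasCompactSupport_partialDeriv hwb.hasCompactSupport i)
    have hcont := continuous_dirFrac h1s i (continuous_partialDeriv hw1 i) hCw
    have hbd : ∀ x, |dirFrac (1 - s) i (partialDeriv i w) x| ≤ (∫ r, fracKernel (1 - s) r) * Cw :=
      fun x => abs_lineFrac_le h1s fun t _ => hCw _
    have i1 : IntegrableOn (fun x => u x * dirFrac (1 - s) i (partialDeriv i w) x) (cube N) :=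
      hu.mul_bdd hcont.aestronglyMeasurable (ae_of_all _ hbd)
    have i2 : IntegrableOn (fun x => u x * f x) (cube N) :=
      hu.mul_bdd hf.continuous.aestronglyMeasurable (ae_of_all _ hCf)
    have h2 : |∫ x in cube N, u x * (dirFrac (1 - s) i (partialDeriv i w) x + abelConst s * f x)|
        ≤ (δ' * C + M * L * ∫ r in (0 : ℝ)..(2 * ε), fracKernel (1 - s) r) * n := by
      refine abs_setIntegral_mul_le hu fun x hx => ?_
      have hxi := hx i (mem_univ i)
      rw [hw_def, dirFrac_partialDeriv_cutoff_mul hs hf hα hb ε hxi.1.le]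
      have e1 : |dirFrac s i f (Function.update x i 0)
          * lineFrac (1 - s) (deriv (cutoff (1 / 4))) (x i)| ≤ δ' * C := by
        rw [abs_mul]
        exact mul_le_mul ((hδ _).trans hδ'.le) (hC _ (Ioo_subset_Icc_self hxi)) (abs_nonneg _)
          (hδ0.trans hδ'.le)
      have e2 := hM (V := fun t => correctedFrac s i f (Function.update x i t)) (L := L) (ε := ε)
        (fun t => hasDerivAt_update_line (hV1.differentiable one_ne_zero) i x t)
        (correctedFrac_update_zero x) (fun t ht => hL _ fun j _ => ?_) hε hε1 hxi.1
      · refine le_trans (le_of_eq ?_) ((abs_sub _ _).trans (add_le_add e1 e2))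
        congr 1
        ring
      · by_cases hj : j = i
        · subst hj; simpa using ht
        · simpa [hj] using Ioo_subset_Icc_self (hx j (mem_univ j))
    have h3 : ∫ x in cube N, u x * (dirFrac (1 - s) i (partialDeriv i w) x + abelConst s * f x)
        = (∫ x in cube N, u x * dirFrac (1 - s) i (partialDeriv i w) x)
          + abelConst s * ∫ x in cube N, u x * f x := by
      rw [← integral_const_mul, ← integral_add i1 (i2.const_mul _)]
      congr 1 with x
      ring
    rw [h3] at h2
    have h4 := abs_sub ((∫ x in cube N, u x * dirFrac (1 - s) i (partialDeriv i w) x)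
          + abelConst s * ∫ x in cube N, u x * f x)
          (∫ x in cube N, u x * dirFrac (1 - s) i (partialDeriv i w) x)
    rw [add_sub_cancel_left, abs_mul, abs_of_pos hB] at h4
    have h5 : Real.Gamma (1 - s) / divConst N s * (2 * δ') * T = D * δ' * T := by
      rw [hD]; ring
    linarith
  have step2 : ∀ δ', δ < δ' → abelConst s * |∫ x in cube N, u x * f x|
      ≤ D * δ' * T + δ' * C * n := by
    intro δ' hδ'
    have ht := (((tendsto_integral_fracKernel h1s).const_mul (M * L)).const_add (δ' * C)).mul_const n
      |>.const_add (D * δ' * T)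
    rw [mul_zero, add_zero] at ht
    refine ge_of_tendsto ht ?_
    filter_upwards [self_mem_nhdsWithin,
      nhdsWithin_le_nhds (gt_mem_nhds (show (0 : ℝ) < 1 / 2 by norm_num))] with ε hε hε2
    exact step δ' hδ' ε hε (by linarith)
  have step3 : abelConst s * |∫ x in cube N, u x * f x| ≤ D * δ * T + δ * C * n := by
    have hc : Continuous fun δ' : ℝ => D * δ' * T + δ' * C * n := by fun_prop
    refine ge_of_tendsto (hc.continuousAt.tendsto.mono_left (nhdsWithin_le_nhds (s := Ioi δ))) ?_
    filter_upwards [self_mem_nhdsWithin] with δ' hδ'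
    exact step2 δ' hδ'
  rw [div_mul_eq_mul_div, div_mul_eq_mul_div, le_div_iff₀ hB, mul_comm]
  refine step3.trans ?_
  have h1 : 0 ≤ D * δ * n := by positivity
  have h2 : 0 ≤ C * δ * T := by positivity
  linarith

end KeyEstimate

/-! ### The `L¹` norm by duality with smooth functions -/

lemma abs_sub_mul_div_sqrt_le {δ : ℝ} (hδ : 0 < δ) (y : ℝ) :
    |y| - y * (y / √(y ^ 2 + δ ^ 2)) ≤ δ := by
  have hpos : 0 < √(y ^ 2 + δ ^ 2) := Real.sqrt_pos.2 (by positivity)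
  have h1 : |y| ≤ √(y ^ 2 + δ ^ 2) := Real.abs_le_sqrt (by nlinarith [sq_nonneg δ])
  have h2 : √(y ^ 2 + δ ^ 2) ≤ |y| + δ := by
    refine Real.sqrt_le_iff.2 ⟨by positivity, ?_⟩
    nlinarith [abs_nonneg y, sq_abs y]
  rw [← mul_div_assoc, sub_le_iff_le_add, ← sub_le_iff_le_add', le_div_iff₀ hpos]
  nlinarith [sq_abs y, abs_nonneg y]

lemma abs_div_sqrt_le_one {δ : ℝ} (hδ : 0 < δ) (y : ℝ) : |y / √(y ^ 2 + δ ^ 2)| ≤ 1 := by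
  have hpos : 0 < √(y ^ 2 + δ ^ 2) := Real.sqrt_pos.2 (by positivity)
  rw [abs_div, abs_of_pos hpos, div_le_one hpos]
  exact Real.abs_le_sqrt (by nlinarith [sq_nonneg δ])

/-- The sign of `f` is replaced by an admissible function: `f` is approximated in `L¹` by a smooth
`g`, the sign of `g` is regularized as `g / √(g² + δ²)`, and a bump `χ` equal to one on `K`
localizes it in `U`. -/
lemma setIntegral_abs_le_of_test_of_isCompact {U K : Set (Fin N → ℝ)} (hU : IsOpen U)
    (hK : IsCompact K) (hKU : K ⊆ U)
    {f : (Fin N → ℝ) → ℝ} (hf : IntegrableOn f U) {M : ℝ}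
    (hM : ∀ ψ : (Fin N → ℝ) → ℝ, ContDiff ℝ ∞ ψ → HasCompactSupport ψ → tsupport ψ ⊆ U →
      (∀ x, |ψ x| ≤ 1) → ∫ x in U, f x * ψ x ≤ M) :
    ∫ x in K, |f x| ≤ M := by
  obtain ⟨χ, hχs, hχc, hχ, hχ01, hχ1⟩ : ∃ χ : (Fin N → ℝ) → ℝ, tsupport χ ⊆ U ∧
      HasCompactSupport χ ∧ ContDiff ℝ ∞ χ ∧ (∀ x, χ x ∈ Icc (0 : ℝ) 1) ∧ ∀ x ∈ K, χ x = 1 := by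
    obtain ⟨V, hV, hKV, hVU, hVc⟩ := exists_open_between_and_isCompact_closure hK hU hKU
    obtain ⟨χ, h1, h2, h3, h4⟩ := exists_contMDiff_support_eq_eq_one_iff (n := ⊤)
      (modelWithCornersSelf ℝ (Fin N → ℝ)) hV hK.isClosed hKV
    have hts : tsupport χ = closure V := by rw [tsupport, h3]
    exact ⟨χ, hts ▸ hVU, by rw [HasCompactSupport, hts]; exact hVc, contMDiff_iff_contDiff.1 h1,
      fun x => h2 (mem_range_self x), fun x hx => (h4 x).1 hx⟩
  have hFi : Integrable (U.indicator f) := hf.integrable_indicator hU.measurableSet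
  refine le_of_forall_pos_le_add fun ε hε => ?_
  obtain ⟨g, hgc, hg, hgε⟩ := (memLp_one_iff_integrable.2 hFi).exist_eLpNorm_sub_le
    (by simp) le_rfl (ε := ε / 4) (by positivity)
  have hgi : Integrable g := hg.continuous.integrable_of_hasCompactSupport hgc
  have hFg : ∫ x, |U.indicator f x - g x| ≤ ε / 4 := by
    have h := hgε
    rw [eLpNorm_one_eq_lintegral_enorm, ← ofReal_integral_norm_eq_lintegral_enorm (hFi.sub hgi),
      ENNReal.ofReal_le_ofReal_iff (by positivity)] at h
    exact h
  have hχi : Integrable χ := hχ.continuous.integrable_of_hasCompactSupport hχc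
  have hI : 0 ≤ ∫ x, χ x := integral_nonneg fun x => (hχ01 x).1
  -- This makes `δ ∫ χ ≤ ε/2`; the other half is twice the approximation error `ε/4`.
  set δ := ε / (2 * ((∫ x, χ x) + 1)) with hδ_def
  have hδ : 0 < δ := by positivity
  set ψ := fun x => χ x * (g x / √(g x ^ 2 + δ ^ 2)) with hψ_def
  have hψ : ContDiff ℝ ∞ ψ := by
    refine hχ.mul (hg.div (((hg.pow 2).add contDiff_const).sqrt fun x => by positivity) fun x => ?_)
    exact (Real.sqrt_pos.2 (by positivity)).ne'
  have hψ1 : ∀ x, |ψ x| ≤ 1 := fun x => by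
    rw [hψ_def, abs_mul, abs_of_nonneg (hχ01 x).1]
    exact mul_le_one₀ (hχ01 x).2 (abs_nonneg _) (abs_div_sqrt_le_one hδ _)
  have hψM := hM ψ hψ hχc.mul_right ((closure_mono fun x hx => left_ne_zero_of_mul hx).trans hχs) hψ1
  have hFψ : ∫ x in U, f x * ψ x = ∫ x, U.indicator f x * ψ x := by
    rw [← integral_indicator hU.measurableSet]
    congr 1 with x
    by_cases hx : x ∈ U <;> simp [hx]
  have hFψi : Integrable fun x => U.indicator f x * ψ x :=
    hFi.mul_bdd hψ.continuous.aestronglyMeasurable (ae_of_all _ hψ1)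
  have hdi : Integrable fun x => |U.indicator f x - g x| := (hFi.sub hgi).abs
  have hFχi : Integrable fun x => |U.indicator f x| * χ x :=
    hFi.abs.mul_bdd (c := 1) hχ.continuous.aestronglyMeasurable (ae_of_all _ fun x => by
      rw [Real.norm_of_nonneg (hχ01 x).1]; exact (hχ01 x).2)
  have hpt : ∀ x, |U.indicator f x| * χ x
      ≤ 2 * |U.indicator f x - g x| + δ * χ x + U.indicator f x * ψ x := by
    intro x
    have h0 := hχ01 x
    have h1 : |U.indicator f x| ≤ |U.indicator f x - g x| + |g x| := by
      simpa using abs_add_le (U.indicator f x - g x) (g x)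
    have h2 := mul_le_mul_of_nonneg_right (abs_sub_mul_div_sqrt_le hδ (g x)) h0.1
    have h3 : (g x - U.indicator f x) * ψ x ≤ |U.indicator f x - g x| := by
      refine (le_abs_self _).trans ?_
      rw [abs_mul, abs_sub_comm]
      exact mul_le_of_le_one_right (abs_nonneg _) (hψ1 x)
    have h4 : g x * (g x / √(g x ^ 2 + δ ^ 2)) * χ x = g x * ψ x := by rw [hψ_def]; ring
    have h5 := mul_le_mul_of_nonneg_right h1 h0.1
    have h6 := mul_le_of_le_one_right (abs_nonneg (U.indicator f x - g x)) h0.2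
    nlinarith
  have hint := integral_mono hFχi (((hdi.const_mul 2).add (hχi.const_mul δ)).add hFψi) hpt
  have e : ∫ x, ((fun x => 2 * |U.indicator f x - g x|) + (fun x => δ * χ x)
      + fun x => U.indicator f x * ψ x) x
      = 2 * (∫ x, |U.indicator f x - g x|) + δ * (∫ x, χ x) + ∫ x, U.indicator f x * ψ x := by
    rw [integral_add' ((hdi.const_mul 2).add (hχi.const_mul δ)) hFψi,
      integral_add' (hdi.const_mul 2) (hχi.const_mul δ), integral_const_mul, integral_const_mul]
  have hδI : δ * (∫ x, χ x) ≤ ε / 2 := by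
    rw [hδ_def, div_mul_eq_mul_div, div_le_div_iff₀ (by positivity) (by positivity)]
    nlinarith
  have hK' : ∫ x in K, |f x| ≤ ∫ x, |U.indicator f x| * χ x := by
    rw [← integral_indicator hK.measurableSet]
    refine integral_mono (IntegrableOn.integrable_indicator (Integrable.abs (hf.mono_set hKU))
      hK.measurableSet) hFχi fun x => ?_
    by_cases hx : x ∈ K
    · simp [hx, hKU hx, hχ1 x hx]
    · simp only [indicator_of_notMem hx]
      exact mul_nonneg (abs_nonneg _) (hχ01 x).1
  have hint' := hint.trans_eq e
  rw [hFψ] at hψM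
  linarith

lemma setIntegral_abs_le_of_test {U : Set (Fin N → ℝ)} (hU : IsOpen U)
    {f : (Fin N → ℝ) → ℝ} (hf : IntegrableOn f U) {M : ℝ}
    (hM : ∀ ψ : (Fin N → ℝ) → ℝ, ContDiff ℝ ∞ ψ → HasCompactSupport ψ → tsupport ψ ⊆ U →
      (∀ x, |ψ x| ≤ 1) → ∫ x in U, f x * ψ x ≤ M) :
    ∫ x in U, |f x| ≤ M := by
  obtain ⟨F, hFc, hFU, hFun, hFm⟩ := hU.exists_iUnion_isClosed
  set K : ℕ → Set (Fin N → ℝ) := fun n => F n ∩ Metric.closedBall 0 n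
  have hKc : ∀ n, IsCompact (K n) := fun n => (isCompact_closedBall _ _).inter_left (hFc n)
  have hKm : Monotone K := fun m n h => inter_subset_inter (hFm h)
    (Metric.closedBall_subset_closedBall (by exact_mod_cast h))
  have hKun : ⋃ n, K n = U := by
    refine subset_antisymm (iUnion_subset fun n => inter_subset_left.trans (hFU n)) fun x hx => ?_
    rw [← hFun] at hx
    obtain ⟨m, hm⟩ := mem_iUnion.1 hx
    obtain ⟨n, hn⟩ := exists_nat_ge ‖x‖
    refine mem_iUnion.2 ⟨max m n, hFm (le_max_left _ _) hm, ?_⟩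
    rw [mem_closedBall_zero_iff]
    exact hn.trans (by exact_mod_cast le_max_right m n)
  have ht := tendsto_setIntegral_of_monotone (f := fun x => |f x|) (μ := volume)
    (fun n => (hKc n).measurableSet) hKm (by rw [hKun]; exact hf.abs)
  rw [hKun] at ht
  exact le_of_tendsto' ht fun n =>
    setIntegral_abs_le_of_test_of_isCompact hU (hKc n) (inter_subset_left.trans (hFU n)) hf hM

/-! ### Smallness of translates -/

/-- The `L¹` modulus of continuity of the truncated kernel. -/
def kernelModulus (s h : ℝ) : ℝ := ∫ r, |fracKernel s (r + h) - fracKernel s r|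

lemma continuousAt_fracKernel {s r : ℝ} (h0 : r ≠ 0) (h1 : r ≠ 1) :
    ContinuousAt (fracKernel s) r := by
  rcases lt_or_gt_of_ne h0 with h | h
  · refine (continuousAt_const (y := (0 : ℝ))).congr ?_
    filter_upwards [gt_mem_nhds h] with t ht
    rw [fracKernel, indicator_of_notMem fun h' => not_lt.2 ht.le h'.1]
  · rcases lt_or_gt_of_ne h1 with h' | h'
    · refine (Real.continuousAt_rpow_const r (s - 1) (Or.inl h0)).congr ?_
      filter_upwards [Ioo_mem_nhds h h'] with t ht
      rw [fracKernel, indicator_of_mem (Ioo_subset_Ioc_self ht)]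
    · refine (continuousAt_const (y := (0 : ℝ))).congr ?_
      filter_upwards [lt_mem_nhds h'] with t ht
      rw [fracKernel, indicator_of_notMem fun h' => not_lt.2 h'.2 ht]

/-- Write `|a - b| = a + b - 2 min a b`. The translates have equal integrals, and the minimum is
dominated by the kernel itself, so dominated convergence needs no majorant of the translates. -/
lemma tendsto_kernelModulus {s : ℝ} (hs : 0 < s) :
    Tendsto (kernelModulus s) (𝓝 0) (𝓝 0) := by
  have hk := integrable_fracKernel hs
  have hkh : ∀ h, Integrable fun r => fracKernel s (r + h) := fun h => hk.comp_add_right h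
  have hmin : ∀ h, Integrable fun r => min (fracKernel s (r + h)) (fracKernel s r) :=
    fun h => (hkh h).inf hk
  have e : ∀ h, kernelModulus s h = 2 * (∫ r, fracKernel s r)
      - 2 * ∫ r, min (fracKernel s (r + h)) (fracKernel s r) := by
    intro h
    have h1 : ∫ r, fracKernel s (r + h) = ∫ r, fracKernel s r :=
      integral_add_right_eq_self _ h
    have h2 : kernelModulus s h = ∫ r, ((fracKernel s (r + h) + fracKernel s r)
        - 2 * min (fracKernel s (r + h)) (fracKernel s r)) := by
      rw [kernelModulus]
      congr 1 with r
      rcases le_total (fracKernel s (r + h)) (fracKernel s r) with hr | hr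
      · rw [min_eq_left hr, abs_of_nonpos (by linarith)]; ring
      · rw [min_eq_right hr, abs_of_nonneg (by linarith)]; ring
    have i1 : Integrable fun r => fracKernel s (r + h) + fracKernel s r := (hkh h).add hk
    rw [h2, integral_sub i1 ((hmin h).const_mul 2), integral_add (hkh h) hk, h1,
      integral_const_mul]
    ring
  have ht : Tendsto (fun h => ∫ r, min (fracKernel s (r + h)) (fracKernel s r)) (𝓝 0)
      (𝓝 (∫ r, fracKernel s r)) := by
    refine tendsto_integral_filter_of_dominated_convergence (fracKernel s)
      (Eventually.of_forall fun h => (hmin h).aestronglyMeasurable)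
      (Eventually.of_forall fun h => ae_of_all _ fun r => ?_) hk ?_
    · rw [Real.norm_of_nonneg (le_min (fracKernel_nonneg _ _) (fracKernel_nonneg _ _))]
      exact min_le_right _ _
    · have h01 : ∀ᵐ r : ℝ, r ≠ 0 ∧ r ≠ 1 :=
        (Measure.ae_ne volume 0).and (Measure.ae_ne volume 1)
      filter_upwards [h01] with r hr
      have h2 : Tendsto (fun h => fracKernel s (r + h)) (𝓝 0) (𝓝 (fracKernel s r)) := by
        have hc : Tendsto (fun h : ℝ => r + h) (𝓝 0) (𝓝 r) := by
          simpa using (by fun_prop : Continuous fun h : ℝ => r + h).tendsto 0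
        exact (continuousAt_fracKernel hr.1 hr.2).tendsto.comp hc
      simpa using h2.min (tendsto_const_nhds (x := fracKernel s r))
  have := (ht.const_mul 2).const_sub (2 * ∫ r, fracKernel s r)
  rw [sub_self] at this
  exact this.congr fun h => (e h).symm

/-- A change of variable moves the translation from `ψ` to the kernel; no regularity of `ψ` enters
the bound. -/
lemma abs_dirFrac_translate_sub_le {s : ℝ} (hs : 0 < s) (i : Fin N) (h : ℝ)
    {ψ : (Fin N → ℝ) → ℝ} (hψ : Continuous ψ) (hψ1 : ∀ x, |ψ x| ≤ 1) (x : Fin N → ℝ) :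
    |dirFrac s i (fun x => ψ (x - Pi.single i h) - ψ x) x| ≤ kernelModulus s h := by
  set v := fun t => ψ (Function.update x i t) with hv_def
  have hv : Continuous v := hψ.comp (continuous_const.update i continuous_id)
  have hk := integrable_fracKernel hs
  have hkh : Integrable fun r => fracKernel s (r + h) := hk.comp_add_right h
  have i1 := integrable_kernel_mul hk (g := fun t => v (t - h)) (by fun_prop)
    (fun t => hψ1 _) (x i)
  have i2 := integrable_kernel_mul hk hv (fun t => hψ1 _) (x i)
  have i3 := integrable_kernel_mul hkh hv (fun t => hψ1 _) (x i)
  have e : dirFrac s i (fun x => ψ (x - Pi.single i h) - ψ x) x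
      = ∫ r, (fracKernel s (r + h) - fracKernel s r) * v (x i + r) := by
    have e1 : ∫ r, fracKernel s r * v (x i + r - h) = ∫ r, fracKernel s (r + h) * v (x i + r) := by
      rw [← integral_add_right_eq_self (fun r => fracKernel s r * v (x i + r - h)) h]
      congr 1 with r
      congr 2
      ring
    have e2 : ∀ t, Function.update x i t - Pi.single i h = Function.update x i (t - h) := by
      intro t
      ext j
      by_cases hj : j = i
      · subst hj; simp
      · simp [hj]
    simp only [dirFrac, lineFrac, e2, mul_sub, sub_mul]
    rw [integral_sub i1 i2, integral_sub i3 i2, ← e1]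
  rw [e, kernelModulus]
  refine norm_integral_le_of_norm_le
    (f := fun r => (fracKernel s (r + h) - fracKernel s r) * v (x i + r))
    (hkh.sub hk).abs (ae_of_all _ fun r => ?_)
  rw [norm_mul]
  exact mul_le_of_le_one_right (norm_nonneg _) (hψ1 _)

/-- The points of the cube that stay in the cube after translation by `h`. -/
def shiftDomain (h : Fin N → ℝ) : Set (Fin N → ℝ) := {x | x ∈ cube N ∧ x + h ∈ cube N}

lemma isOpen_shiftDomain (h : Fin N → ℝ) : IsOpen (shiftDomain h) :=
  isOpen_cube.inter (isOpen_cube.preimage (continuous_id.add continuous_const))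

lemma integrableOn_translate {u : (Fin N → ℝ) → ℝ} (hu : IntegrableOn u (cube N))
    (h : Fin N → ℝ) : IntegrableOn (fun x => u (x + h)) (shiftDomain h) := by
  have h1 := (hu.integrable_indicator measurableSet_cube).comp_add_right h
  refine h1.integrableOn.congr_fun (fun x hx => ?_) (isOpen_shiftDomain h).measurableSet
  simp only [indicator_of_mem hx.2]

/-- Summation by parts for differences: extend `u` by zero and use translation invariance of the
integral. -/
lemma setIntegral_translate_sub_mul {u ψ : (Fin N → ℝ) → ℝ} (hu : IntegrableOn u (cube N))
    (h : Fin N → ℝ) (hψ : Continuous ψ) (hsub : tsupport ψ ⊆ shiftDomain h)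
    (hψ1 : ∀ x, |ψ x| ≤ 1) :
    ∫ x in shiftDomain h, (u (x + h) - u x) * ψ x
      = ∫ x in cube N, u x * (ψ (x - h) - ψ x) := by
  have hm := (isOpen_shiftDomain h).measurableSet
  have hI := hu.integrable_indicator measurableSet_cube
  have hz : ∀ x, x ∉ shiftDomain h → ψ x = 0 := fun x hx => by
    by_contra h'
    exact hx (hsub (subset_tsupport ψ h'))
  have i0 : Integrable fun x => (cube N).indicator u x * ψ (x - h) :=
    hI.mul_bdd (hψ.comp (by fun_prop)).aestronglyMeasurable (ae_of_all _ fun x => hψ1 _)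
  have i1 : Integrable fun x => (cube N).indicator u x * ψ x :=
    hI.mul_bdd hψ.aestronglyMeasurable (ae_of_all _ fun x => hψ1 _)
  have i2 : Integrable fun x => (cube N).indicator u (x + h) * ψ x :=
    (hI.comp_add_right h).mul_bdd hψ.aestronglyMeasurable (ae_of_all _ fun x => hψ1 _)
  have e : ∫ x, (cube N).indicator u (x + h) * ψ x = ∫ x, (cube N).indicator u x * ψ (x - h) := by
    rw [← integral_add_right_eq_self (fun x => (cube N).indicator u x * ψ (x - h)) h]
    simp
  calc ∫ x in shiftDomain h, (u (x + h) - u x) * ψ x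
      = ∫ x, ((cube N).indicator u (x + h) * ψ x - (cube N).indicator u x * ψ x) := by
        rw [← integral_indicator hm]
        congr 1 with x
        by_cases hx : x ∈ shiftDomain h
        · rw [indicator_of_mem hx, indicator_of_mem hx.1, indicator_of_mem hx.2, sub_mul]
        · simp [hx, hz x hx]
    _ = ∫ x, (cube N).indicator (fun x => u x * (ψ (x - h) - ψ x)) x := by
        rw [integral_sub i2 i1, e, ← integral_sub i0 i1]
        congr 1 with x
        by_cases hx : x ∈ cube N <;> simp [hx, mul_sub]
    _ = _ := integral_indicator measurableSet_cube

/-- Uniform smallness of the translates in the coordinate directions. -/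
theorem exists_setIntegral_translate_sub_le (hN : 1 ≤ N) {s : ℝ} (hs : s ∈ Ioo (0 : ℝ) 1) :
    ∃ A, 0 ≤ A ∧ ∀ {p : ℝ≥0∞} {u : (Fin N → ℝ) → ℝ} (i : Fin N) (h : ℝ), 1 ≤ p →
      IntegrableOn u (cube N) → fracTV s p u < ⊤ →
      ∫ x in shiftDomain (Pi.single i h), |u (x + Pi.single i h) - u x|
        ≤ A * kernelModulus s h * ((∫ x in cube N, |u x|) + (fracTV s p u).toReal) := by
  obtain ⟨A, hA, H⟩ := exists_integral_mul_le hN hs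
  refine ⟨A, hA, fun {p u} i h hp hu hTV => ?_⟩
  refine setIntegral_abs_le_of_test (f := fun x => u (x + Pi.single i h) - u x)
    (isOpen_shiftDomain _)
    ((integrableOn_translate hu _).sub (hu.mono_set fun x hx => hx.1)) ?_
  intro ψ hψ hψc hψs hψ1
  rw [setIntegral_translate_sub_mul hu _ hψ.continuous hψs hψ1]
  have hts : tsupport (fun x => ψ (x - Pi.single i h)) ⊆ cube N := by
    have h1 : tsupport (fun x => ψ (x - Pi.single i h))
        ⊆ (fun x : Fin N → ℝ => x - (Pi.single i h : Fin N → ℝ)) ⁻¹' tsupport ψ := by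
      refine closure_minimal (fun x hx => subset_tsupport ψ hx) ?_
      exact (isClosed_tsupport ψ).preimage (continuous_id.sub continuous_const)
    intro x hx
    simpa using (hψs (h1 hx)).2
  refine (le_abs_self _).trans (H hp hu hTV
    ((hψ.comp (contDiff_id.sub contDiff_const)).sub hψ) ?_ ?_
    (abs_dirFrac_translate_sub_le hs.1 i h hψ.continuous hψ1))
  · exact (hψc.comp_homeomorph (Homeomorph.subRight (Pi.single i h))).sub hψc
  · refine (tsupport_sub _ _).trans (union_subset hts (hψs.trans fun x hx => hx.1))

/-! ### Kolmogorov–Riesz compactness on the cube -/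

/-- The `L¹` size of the increment of `u` under translation by `h`, inside the cube. -/
def translateIncr (u : (Fin N → ℝ) → ℝ) (h : Fin N → ℝ) : ℝ≥0∞ :=
  ∫⁻ x in shiftDomain h, ‖u (x + h) - u x‖ₑ

/-- The coordinates are moved one at a time, each move costing at most `η`. -/
lemma lintegral_partial_translate_le {u : (Fin N → ℝ) → ℝ} (hu : Measurable u) {η : ℝ≥0∞}
    {h : Fin N → ℝ} (hη : ∀ i, translateIncr u (Pi.single i (h i)) ≤ η) (S : Finset (Fin N)) :
    ∫⁻ x in shiftDomain h, ‖u (x + (S : Set (Fin N)).indicator h) - u x‖ₑ ≤ S.card * η := by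
  classical
  induction S using Finset.induction_on with
  | empty =>
    have h0 : ((∅ : Finset (Fin N)) : Set (Fin N)).indicator h = 0 := by ext; simp
    rw [h0]
    simp
  | insert a S ha ih =>
    set k := (S : Set (Fin N)).indicator h with hk
    have hins : ((insert a S : Finset (Fin N)) : Set (Fin N)).indicator h
        = k + Pi.single a (h a) := by
      ext j
      by_cases hj : j = a
      · subst hj
        simp [hk, ha]
      · by_cases hjS : j ∈ S <;> simp [hk, hj, hjS]
    -- Intermediate points have coordinates `xⱼ` or `xⱼ + hⱼ`, so they stay in the cube because it
    -- is a product.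
    have hmem : ∀ x ∈ shiftDomain h, x + k ∈ shiftDomain (Pi.single a (h a)) := by
      intro x hx
      refine ⟨fun j hj => ?_, fun j hj => ?_⟩
      · by_cases hjS : j ∈ S
        · simpa [hk, hjS] using hx.2 j hj
        · simpa [hk, hjS] using hx.1 j hj
      · rw [add_assoc, ← hins]
        by_cases hjS : j ∈ insert a S
        · rw [Pi.add_apply, indicator_of_mem (Finset.mem_coe.2 hjS)]
          exact hx.2 j hj
        · rw [Pi.add_apply, indicator_of_notMem (Finset.mem_coe.not.2 hjS), add_zero]
          exact hx.1 j hj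
    have step : ∫⁻ x in shiftDomain h, ‖u (x + k + Pi.single a (h a)) - u (x + k)‖ₑ ≤ η := by
      refine le_trans ?_ (hη a)
      rw [translateIncr, ← lintegral_indicator (isOpen_shiftDomain _).measurableSet,
        ← lintegral_indicator (isOpen_shiftDomain _).measurableSet,
        ← lintegral_add_right_eq_self ((shiftDomain (Pi.single a (h a))).indicator _) k]
      refine lintegral_mono fun x => ?_
      by_cases hx : x ∈ shiftDomain h
      · rw [indicator_of_mem hx, indicator_of_mem (hmem x hx)]
      · simp [hx]
    calc ∫⁻ x in shiftDomain h,
          ‖u (x + ((insert a S : Finset (Fin N)) : Set (Fin N)).indicator h) - u x‖ₑ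
        ≤ ∫⁻ x in shiftDomain h, (‖u (x + k + Pi.single a (h a)) - u (x + k)‖ₑ
            + ‖u (x + k) - u x‖ₑ) := by
          refine lintegral_mono fun x => ?_
          rw [hins, ← add_assoc]
          refine le_trans (le_of_eq ?_) (enorm_add_le _ _)
          rw [sub_add_sub_cancel]
      _ = (∫⁻ x in shiftDomain h, ‖u (x + k + Pi.single a (h a)) - u (x + k)‖ₑ)
            + ∫⁻ x in shiftDomain h, ‖u (x + k) - u x‖ₑ := by
          rw [lintegral_add_left (by fun_prop)]
      _ ≤ η + S.card * η := add_le_add step ih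
      _ = ((insert a S).card : ℝ≥0∞) * η := by
          rw [Finset.card_insert_of_notMem ha]
          push_cast
          ring

lemma translateIncr_le {u : (Fin N → ℝ) → ℝ} (hu : Measurable u) {η : ℝ≥0∞}
    {h : Fin N → ℝ} (hη : ∀ i, translateIncr u (Pi.single i (h i)) ≤ η) :
    translateIncr u h ≤ N * η := by
  simpa [translateIncr] using lintegral_partial_translate_le hu hη Finset.univ

/-- Substitute `y = x + h` and exchange the integrals by Tonelli. -/
lemma lintegral_near_diagonal_le {u : (Fin N → ℝ) → ℝ} (hu : Measurable u) {η : ℝ≥0∞} {ρ : ℝ}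
    (hη : ∀ h ∈ Metric.ball (0 : Fin N → ℝ) ρ, translateIncr u h ≤ η) :
    ∫⁻ x in cube N, ∫⁻ y in cube N ∩ Metric.ball x ρ, ‖u y - u x‖ₑ
      ≤ volume (Metric.ball (0 : Fin N → ℝ) ρ) * η := by
  set G : (Fin N → ℝ) → (Fin N → ℝ) → ℝ≥0∞ := fun x h =>
    (Metric.ball (0 : Fin N → ℝ) ρ).indicator
      (fun h => (shiftDomain h).indicator (fun x => ‖u (x + h) - u x‖ₑ) x) h with hG
  have hGm : Measurable (Function.uncurry G) := by
    have e : Function.uncurry G = ({q : (Fin N → ℝ) × (Fin N → ℝ) |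
        q.2 ∈ Metric.ball 0 ρ ∧ q.1 ∈ cube N ∧ q.1 + q.2 ∈ cube N}).indicator
        (fun q => ‖u (q.1 + q.2) - u q.1‖ₑ) := by
      ext q
      obtain ⟨x, h⟩ := q
      by_cases h1 : h ∈ Metric.ball (0 : Fin N → ℝ) ρ
      · by_cases h2 : x ∈ shiftDomain h
        · have h3 : (x, h) ∈ {q : (Fin N → ℝ) × (Fin N → ℝ) |
            q.2 ∈ Metric.ball 0 ρ ∧ q.1 ∈ cube N ∧ q.1 + q.2 ∈ cube N} := ⟨h1, h2⟩
          simp only [Function.uncurry_apply_pair, hG, indicator_of_mem h1, indicator_of_mem h2,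
            indicator_of_mem h3]
        · have h3 : (x, h) ∉ {q : (Fin N → ℝ) × (Fin N → ℝ) |
            q.2 ∈ Metric.ball 0 ρ ∧ q.1 ∈ cube N ∧ q.1 + q.2 ∈ cube N} := fun h' => h2 h'.2
          simp only [Function.uncurry_apply_pair, hG, indicator_of_mem h1, indicator_of_notMem h2,
            indicator_of_notMem h3]
      · have h3 : (x, h) ∉ {q : (Fin N → ℝ) × (Fin N → ℝ) |
            q.2 ∈ Metric.ball 0 ρ ∧ q.1 ∈ cube N ∧ q.1 + q.2 ∈ cube N} := fun h' => h1 h'.1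
        simp only [Function.uncurry_apply_pair, hG, indicator_of_notMem h1, indicator_of_notMem h3]
    rw [e]
    refine Measurable.indicator (by fun_prop) ?_
    exact (measurable_snd measurableSet_ball).inter ((measurable_fst measurableSet_cube).inter
      ((measurable_fst.add measurable_snd) measurableSet_cube))
  calc ∫⁻ x in cube N, ∫⁻ y in cube N ∩ Metric.ball x ρ, ‖u y - u x‖ₑ
      ≤ ∫⁻ x, ∫⁻ h, G x h := by
        rw [← lintegral_indicator measurableSet_cube]
        refine lintegral_mono fun x => ?_
        by_cases hx : x ∈ cube N
        · rw [indicator_of_mem hx, ← lintegral_indicator (measurableSet_cube.inter measurableSet_ball),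
            ← lintegral_add_left_eq_self _ x]
          refine lintegral_mono fun h => ?_
          by_cases hh : x + h ∈ cube N ∩ Metric.ball x ρ
          · have h1 : h ∈ Metric.ball (0 : Fin N → ℝ) ρ := by simpa using hh.2
            have h2 : x ∈ shiftDomain h := ⟨hx, hh.1⟩
            simp only [hG, indicator_of_mem hh, indicator_of_mem h1, indicator_of_mem h2, le_refl]
          · simp only [indicator_of_notMem hh, zero_le]
        · simp [hx]
    _ = ∫⁻ h, ∫⁻ x, G x h := lintegral_lintegral_swap hGm.aemeasurable
    _ ≤ ∫⁻ h, (Metric.ball (0 : Fin N → ℝ) ρ).indicator (fun _ => η) h := by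
        refine lintegral_mono fun h => ?_
        by_cases h1 : h ∈ Metric.ball (0 : Fin N → ℝ) ρ
        · simp only [hG, indicator_of_mem h1]
          rw [lintegral_indicator (isOpen_shiftDomain h).measurableSet]
          exact hη h h1
        · simp [hG, h1]
    _ = _ := by
        rw [lintegral_indicator_const measurableSet_ball, mul_comm]

/-- The deviation from the mean is the mean of the differences `u x - u y`. -/
lemma lintegral_sub_average_le {μ : Measure (Fin N → ℝ)} {B : Set (Fin N → ℝ)}
    (hB0 : μ B ≠ 0) (hBt : μ B ≠ ⊤) {u : (Fin N → ℝ) → ℝ} (hu : IntegrableOn u B μ) :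
    ∫⁻ x in B, ‖u x - ⨍ y in B, u y ∂μ‖ₑ ∂μ
      ≤ (μ B)⁻¹ * ∫⁻ x in B, ∫⁻ y in B, ‖u y - u x‖ₑ ∂μ ∂μ := by
  have hpt : ∀ x, ‖u x - ⨍ y in B, u y ∂μ‖ₑ ≤ (μ B)⁻¹ * ∫⁻ y in B, ‖u y - u x‖ₑ ∂μ := by
    intro x
    have hr : μ.real B ≠ 0 := (ENNReal.toReal_pos hB0 hBt).ne'
    have e : u x - ⨍ y in B, u y ∂μ = -((μ.real B)⁻¹ * ∫ y in B, (u y - u x) ∂μ) := by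
      have hc : IntegrableOn (fun _ => u x) B μ := integrableOn_const hBt
      rw [integral_sub hu hc, setIntegral_const, setAverage_eq]
      simp only [smul_eq_mul]
      field_simp
      ring
    rw [e, enorm_neg, enorm_mul]
    refine mul_le_mul' (le_of_eq ?_) (enorm_integral_le_lintegral_enorm _)
    rw [enorm_inv hr, Real.enorm_of_nonneg measureReal_nonneg, measureReal_def,
      ENNReal.ofReal_toReal hBt]
  refine (lintegral_mono hpt).trans (le_of_eq ?_)
  rw [lintegral_const_mul' _ _ (ENNReal.inv_ne_top.2 hB0)]

/-- The cell with index `k` of the partition of the cube into cells of side `1/m`. -/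
def cell (m : ℕ) (k : Fin N → Fin m) : Set (Fin N → ℝ) :=
  cube N ∩ univ.pi fun j => Ioc ((k j : ℝ) / m) (((k j : ℝ) + 1) / m)

lemma measurableSet_cell (m : ℕ) (k : Fin N → Fin m) : MeasurableSet (cell m k) :=
  measurableSet_cube.inter (MeasurableSet.univ_pi fun _ => measurableSet_Ioc)

lemma iUnion_cell {m : ℕ} (hm : 0 < m) : ⋃ k : Fin N → Fin m, cell m k = cube N := by
  refine subset_antisymm (iUnion_subset fun k => inter_subset_left) fun x hx => ?_
  have hm' : (0 : ℝ) < m := by exact_mod_cast hm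
  have h : ∀ j, ∃ k : Fin m, x j ∈ Ioc ((k : ℝ) / m) (((k : ℝ) + 1) / m) := by
    intro j
    have hxj := hx j (mem_univ j)
    have hpos : 0 < m * x j := mul_pos hm' hxj.1
    have hc : 0 < ⌈m * x j⌉₊ := Nat.ceil_pos.2 hpos
    have hle : ⌈m * x j⌉₊ ≤ m := Nat.ceil_le.2 (by nlinarith [hxj.2])
    have h1 : m * x j ≤ ⌈m * x j⌉₊ := Nat.le_ceil _
    have h2 : (⌈m * x j⌉₊ : ℝ) < m * x j + 1 := Nat.ceil_lt_add_one hpos.le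
    have hcast : ((⌈m * x j⌉₊ - 1 : ℕ) : ℝ) = ⌈m * x j⌉₊ - 1 := by
      rw [Nat.cast_sub hc, Nat.cast_one]
    -- The intervals are open on the left and closed on the right, so the index is the ceiling minus
    -- one.
    refine ⟨⟨⌈m * x j⌉₊ - 1, by omega⟩, ?_, ?_⟩
    · rw [div_lt_iff₀ hm', hcast]
      linarith
    · rw [le_div_iff₀ hm', hcast]
      linarith
  choose k hk using h
  exact mem_iUnion.2 ⟨k, hx, fun j _ => hk j⟩

lemma pairwise_disjoint_cell {m : ℕ} (hm : 0 < m) :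
    Pairwise (Function.onFun Disjoint (cell (N := N) m)) := by
  intro k l hkl
  rw [Function.onFun, Set.disjoint_left]
  intro x hxk hxl
  have hm' : (0 : ℝ) < m := by exact_mod_cast hm
  refine hkl (funext fun j => Fin.ext ?_)
  have h1 := hxk.2 j (mem_univ j)
  have h2 := hxl.2 j (mem_univ j)
  have h3 : ((k j : ℕ) : ℝ) < (l j : ℕ) + 1 := (div_lt_div_iff_of_pos_right hm').1 (h1.1.trans_le h2.2)
  have h4 : ((l j : ℕ) : ℝ) < (k j : ℕ) + 1 := (div_lt_div_iff_of_pos_right hm').1 (h2.1.trans_le h1.2)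
  have h3' : (k j : ℕ) < (l j : ℕ) + 1 := by exact_mod_cast h3
  have h4' : (l j : ℕ) < (k j : ℕ) + 1 := by exact_mod_cast h4
  omega

lemma volume_cell_ge {m : ℕ} (hm : 0 < m) (k : Fin N → Fin m) :
    (ENNReal.ofReal (1 / m)) ^ N ≤ volume (cell m k) := by
  have hm' : (0 : ℝ) < m := by exact_mod_cast hm
  have h : (univ.pi fun j => Ioo ((k j : ℝ) / m) (((k j : ℝ) + 1) / m)) ⊆ cell m k := by
    intro x hx
    refine ⟨fun j hj => ⟨?_, ?_⟩, fun j hj => Ioo_subset_Ioc_self (hx j hj)⟩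
    · exact lt_of_le_of_lt (by positivity) (hx j hj).1
    · refine (hx j hj).2.trans_le ?_
      rw [div_le_one hm']
      exact_mod_cast (k j).2
  refine le_trans (le_of_eq ?_) (measure_mono h)
  rw [Real.volume_pi_Ioo]
  have : ∀ j, ((k j : ℝ) + 1) / m - (k j : ℝ) / m = 1 / m := fun j => by ring
  simp [this]

lemma volume_cube_lt_top : volume (cube N) < ⊤ := by
  rw [cube, Real.volume_pi_Ioo]
  simp

lemma volume_cell_lt_top (m : ℕ) (k : Fin N → Fin m) : volume (cell m k) < ⊤ :=
  (measure_mono inter_subset_left).trans_lt volume_cube_lt_top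

lemma volume_cell_ne_zero {m : ℕ} (hm : 0 < m) (k : Fin N → Fin m) : volume (cell m k) ≠ 0 := by
  have hm' : (0 : ℝ) < m := by exact_mod_cast hm
  exact (lt_of_lt_of_le (ENNReal.pow_pos (ENNReal.ofReal_pos.2 (by positivity)) N)
    (volume_cell_ge hm k)).ne'

lemma cell_subset_ball {m : ℕ} (hm : 0 < m) {k : Fin N → Fin m} {x : Fin N → ℝ}
    (hx : x ∈ cell m k) : cell m k ⊆ cube N ∩ Metric.ball x (1 / m) := by
  have hm' : (0 : ℝ) < m := by exact_mod_cast hm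
  intro y hy
  refine ⟨hy.1, ?_⟩
  rw [Metric.mem_ball, dist_pi_lt_iff (by positivity)]
  intro j
  have h1 := hx.2 j (mem_univ j)
  have h2 := hy.2 j (mem_univ j)
  have h3 : ((k j : ℝ) + 1) / m = (k j : ℝ) / m + 1 / m := by ring
  rw [Real.dist_eq, abs_lt]
  constructor <;> linarith [h1.1, h1.2, h2.1, h2.2]

/-- Piecewise constant approximation on the cells. -/
lemma sum_lintegral_cell_le {u : (Fin N → ℝ) → ℝ} (hu : Measurable u)
    (hi : IntegrableOn u (cube N)) {m : ℕ} (hm : 0 < m) {η : ℝ≥0∞}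
    (hη : ∀ i, ∀ t : ℝ, |t| < 1 / m → translateIncr u (Pi.single i t) ≤ η) :
    ∑ k : Fin N → Fin m, ∫⁻ x in cell m k, ‖u x - ⨍ y in cell m k, u y‖ₑ
      ≤ 2 ^ N * (N * η) := by
  have hm' : (0 : ℝ) < m := by exact_mod_cast hm
  set c := ENNReal.ofReal (1 / m) with hc
  have hc0 : c ≠ 0 := (ENNReal.ofReal_pos.2 (by positivity)).ne'
  have hct : c ≠ ⊤ := ENNReal.ofReal_ne_top
  have hG := lintegral_near_diagonal_le hu (ρ := 1 / m) (η := N * η) fun h hh =>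
    translateIncr_le hu fun i => hη i _ (lt_of_le_of_lt (norm_le_pi_norm h i) (by simpa using hh))
  calc ∑ k : Fin N → Fin m, ∫⁻ x in cell m k, ‖u x - ⨍ y in cell m k, u y‖ₑ
      ≤ ∑ k : Fin N → Fin m, (c ^ N)⁻¹ *
          ∫⁻ x in cell m k, ∫⁻ y in cube N ∩ Metric.ball x (1 / m), ‖u y - u x‖ₑ := by
        refine Finset.sum_le_sum fun k _ => ?_
        refine (lintegral_sub_average_le (volume_cell_ne_zero hm k) (volume_cell_lt_top m k).ne
          (hi.mono_set inter_subset_left)).trans ?_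
        refine mul_le_mul' (ENNReal.inv_le_inv.2 (volume_cell_ge hm k)) ?_
        refine setLIntegral_mono' (measurableSet_cell m k) fun x hx => ?_
        exact lintegral_mono_set (cell_subset_ball hm hx)
    _ = (c ^ N)⁻¹ * ∫⁻ x in cube N, ∫⁻ y in cube N ∩ Metric.ball x (1 / m), ‖u y - u x‖ₑ := by
        rw [← Finset.mul_sum, ← iUnion_cell (N := N) hm,
          lintegral_iUnion (measurableSet_cell m) (pairwise_disjoint_cell hm), tsum_fintype]
    _ ≤ (c ^ N)⁻¹ * (volume (Metric.ball (0 : Fin N → ℝ) (1 / m)) * (N * η)) := by gcongr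
    -- A ball of radius `1/m` in the sup norm has side `2/m`, hence `2^N` times the lower bound for
    -- the volume of a cell.
    _ = 2 ^ N * (N * η) := by
        rw [Real.volume_pi_ball _ (by positivity), ENNReal.ofReal_pow (by positivity),
          ENNReal.ofReal_mul (by norm_num), ← hc, Fintype.card_fin, mul_pow,
          mul_comm _ (c ^ N), mul_assoc, ← mul_assoc, ENNReal.inv_mul_cancel (pow_ne_zero _ hc0)
          (ENNReal.pow_ne_top hct), one_mul]
        simp

lemma normL1_eq_lintegral (u : (Fin N → ℝ) → ℝ) : normL1 u = ∫⁻ x in cube N, ‖u x‖ₑ :=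
  eLpNorm_one_eq_lintegral_enorm

lemma normL1_eq_ofReal {u : (Fin N → ℝ) → ℝ} (hu : IntegrableOn u (cube N)) :
    normL1 u = ENNReal.ofReal (∫ x in cube N, |u x|) := by
  rw [normL1_eq_lintegral, ← ofReal_integral_norm_eq_lintegral_enorm hu]
  rfl

/-- The step function with value `a k` on the cell with index `k`, as an element of `L¹`. -/
def cellStep (m : ℕ) (a : (Fin N → Fin m) → ℝ) : Lp ℝ 1 (volume.restrict (cube N)) :=
  ∑ k, a k • indicatorConstLp 1 (measurableSet_cell m k)
    (((Measure.restrict_apply_le _ _).trans_lt (volume_cell_lt_top m k)).ne) (1 : ℝ)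

lemma continuous_cellStep (m : ℕ) : Continuous (cellStep (N := N) m) :=
  continuous_finsetSum _ fun k _ => (continuous_apply k).smul continuous_const

lemma coeFn_cellStep {m : ℕ} (hm : 0 < m) (a : (Fin N → Fin m) → ℝ) :
    ∀ᵐ x ∂(volume.restrict (cube N)), ∀ k, x ∈ cell m k → cellStep m a x = a k := by
  have h1 := Lp.coeFn_fun_finsetSum (p := 1) (μ := volume.restrict (cube N)) Finset.univ
    fun k => a k • indicatorConstLp 1 (measurableSet_cell m k)
      (((Measure.restrict_apply_le _ _).trans_lt (volume_cell_lt_top m k)).ne) (1 : ℝ)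
  have h2 : ∀ᵐ x ∂(volume.restrict (cube N)), ∀ k : Fin N → Fin m,
      (a k • indicatorConstLp (E := ℝ) 1 (measurableSet_cell m k)
        (((Measure.restrict_apply_le (cube N) _).trans_lt (volume_cell_lt_top m k)).ne) 1 :
        Lp ℝ 1 (volume.restrict (cube N))) x = a k * (cell m k).indicator (fun _ => (1 : ℝ)) x := by
    refine ae_all_iff.2 fun k => ?_
    filter_upwards [Lp.coeFn_smul (a k) (indicatorConstLp (E := ℝ) 1 (measurableSet_cell m k)
      (((Measure.restrict_apply_le (cube N) _).trans_lt (volume_cell_lt_top m k)).ne) 1),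
      indicatorConstLp_coeFn (p := 1) (hs := measurableSet_cell m k)
      (hμs := ((Measure.restrict_apply_le (cube N) _).trans_lt (volume_cell_lt_top m k)).ne)
      (c := (1 : ℝ))] with x hx hx'
    rw [hx, Pi.smul_apply, hx', smul_eq_mul]
  filter_upwards [h1, h2] with x hx1 hx2 k hk
  rw [cellStep, hx1, Finset.sum_eq_single k]
  · rw [hx2, indicator_of_mem hk, mul_one]
  · intro l _ hl
    have : x ∉ cell m l := fun h => Set.disjoint_left.1 (pairwise_disjoint_cell hm hl) h hk
    rw [hx2, indicator_of_notMem this, mul_zero]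
  · simp

lemma lintegral_cube_eq_sum {m : ℕ} (hm : 0 < m) (F : (Fin N → ℝ) → ℝ≥0∞) :
    ∫⁻ x in cube N, F x = ∑ k : Fin N → Fin m, ∫⁻ x in cell m k, F x := by
  rw [← iUnion_cell (N := N) hm, lintegral_iUnion (measurableSet_cell m)
    (pairwise_disjoint_cell hm), tsum_fintype]

lemma edist_toL1_cellStep {u : (Fin N → ℝ) → ℝ} (hu : IntegrableOn u (cube N)) {m : ℕ}
    (hm : 0 < m) (a : (Fin N → Fin m) → ℝ) :
    edist (Integrable.toL1 u hu) (cellStep m a)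
      = ∑ k : Fin N → Fin m, ∫⁻ x in cell m k, ‖u x - a k‖ₑ := by
  rw [Lp.edist_def, eLpNorm_one_eq_lintegral_enorm]
  have h1 : ∀ᵐ x ∂(volume.restrict (cube N)), ∀ k, x ∈ cell m k →
      ‖(⇑(Integrable.toL1 u hu) - ⇑(cellStep m a)) x‖ₑ = ‖u x - a k‖ₑ := by
    filter_upwards [coeFn_cellStep hm a, Integrable.coeFn_toL1 hu] with x hx hx' k hk
    rw [Pi.sub_apply, hx k hk, hx']
  rw [lintegral_cube_eq_sum hm]
  refine Finset.sum_congr rfl fun k _ => lintegral_congr_ae ?_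
  filter_upwards [ae_restrict_of_ae_restrict_of_subset inter_subset_left h1,
    ae_restrict_mem (measurableSet_cell m k)] with x hx hx'
  exact hx k hx'

/-- A sequence that is bounded in `L¹` of the cube and equicontinuous in mean in the coordinate
directions has a convergent subsequence. -/
theorem exists_tendsto_subseq {u : ℕ → (Fin N → ℝ) → ℝ} (hm : ∀ n, Measurable (u n))
    (hi : ∀ n, IntegrableOn (u n) (cube N)) {R : ℝ} (hR : ∀ n, ∫ x in cube N, |u n x| ≤ R)
    (hη : ∀ η : ℝ, 0 < η → ∃ ρ, 0 < ρ ∧ ∀ n i (t : ℝ), |t| < ρ →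
      translateIncr (u n) (Pi.single i t) ≤ ENNReal.ofReal η) :
    ∃ v : (Fin N → ℝ) → ℝ, IntegrableOn v (cube N) ∧ ∃ k : ℕ → ℕ, StrictMono k ∧
      Tendsto (fun n => normL1 fun x => u (k n) x - v x) atTop (𝓝 0) := by
  set L : ℕ → Lp ℝ 1 (volume.restrict (cube N)) := fun n => Integrable.toL1 (u n) (hi n) with hL
  have htb : TotallyBounded (range L) := by
    rw [Metric.totallyBounded_iff]
    intro ε hε
    -- This choice makes the cell error `2^N N η` at most `ε/2`.
    set η : ℝ := ε / 2 / (2 ^ N * (N + 1)) with hη_def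
    obtain ⟨ρ, hρ, hρ'⟩ := hη η (by positivity)
    obtain ⟨j, hj⟩ := exists_nat_one_div_lt hρ
    set m := j + 1
    have hm0 : 0 < m := Nat.succ_pos j
    have hj' : 1 / (m : ℝ) < ρ := by exact_mod_cast hj
    -- The `L¹` bound confines the cell averages to a compact box, so all the step approximations
    -- lie in one compact set.
    set C := cellStep (N := N) m '' (univ.pi fun k =>
      Icc (-((volume.real (cell m k))⁻¹ * R)) ((volume.real (cell m k))⁻¹ * R)) with hC
    have hCc : IsCompact C :=
      (isCompact_univ_pi fun _ => isCompact_Icc).image (continuous_cellStep m)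
    obtain ⟨t, ht, htC⟩ := Metric.totallyBounded_iff.1 hCc.totallyBounded (ε / 2) (by positivity)
    refine ⟨t, ht, ?_⟩
    rintro _ ⟨n, rfl⟩
    set a : (Fin N → Fin m) → ℝ := fun k => ⨍ y in cell m k, u n y with ha
    have haC : cellStep m a ∈ C := by
      refine mem_image_of_mem _ fun k _ => abs_le.1 ?_
      rw [ha]
      simp only [setAverage_eq, smul_eq_mul]
      rw [abs_mul, abs_of_nonneg (inv_nonneg.2 measureReal_nonneg)]
      refine mul_le_mul_of_nonneg_left ?_ (inv_nonneg.2 measureReal_nonneg)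
      refine (abs_integral_le_integral_abs).trans (le_trans ?_ (hR n))
      exact setIntegral_mono_set (hi n).abs (ae_of_all _ fun _ => abs_nonneg _)
        (LE.le.eventuallyLE inter_subset_left)
    obtain ⟨y, hy, hya⟩ := mem_iUnion₂.1 (htC haC)
    refine mem_iUnion₂.2 ⟨y, hy, ?_⟩
    have hd : dist (L n) (cellStep m a) ≤ ε / 2 := by
      have h1 := sum_lintegral_cell_le (hm n) (hi n) hm0 (η := ENNReal.ofReal η)
        fun i t ht => hρ' n i t (ht.trans hj')
      rw [← edist_toL1_cellStep (hi n) hm0 a, edist_dist] at h1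
      have h2 : (2 : ℝ≥0∞) ^ N * (N * ENNReal.ofReal η) ≤ ENNReal.ofReal (ε / 2) := by
        have e : (2 : ℝ≥0∞) ^ N * (N * ENNReal.ofReal η) = ENNReal.ofReal (2 ^ N * (N * η)) := by
          rw [ENNReal.ofReal_mul (by positivity), ENNReal.ofReal_mul (by positivity),
            ENNReal.ofReal_pow (by norm_num)]
          simp
        rw [e]
        refine ENNReal.ofReal_le_ofReal ?_
        rw [hη_def, ← mul_assoc, mul_div_assoc', div_le_iff₀ (by positivity)]
        have : (0 : ℝ) < 2 ^ N := by positivity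
        nlinarith
      exact (ENNReal.ofReal_le_ofReal_iff (by positivity)).1 (h1.trans h2)
    rw [Metric.mem_ball] at hya ⊢
    linarith [dist_triangle (L n) (cellStep m a) y]
  have hcomp : IsCompact (closure (range L)) :=
    htb.closure.isCompact_of_isClosed isClosed_closure
  obtain ⟨v, -, k, hk, hv⟩ := hcomp.tendsto_subseq fun n => subset_closure (mem_range_self n)
  refine ⟨v, memLp_one_iff_integrable.1 (Lp.memLp v), k, hk, ?_⟩
  rw [tendsto_iff_edist_tendsto_0] at hv
  refine hv.congr fun n => ?_
  rw [Function.comp_apply, Lp.edist_def, normL1]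
  refine eLpNorm_congr_ae ?_
  filter_upwards [Integrable.coeFn_toL1 (hi (k n))] with x hx
  rw [Pi.sub_apply, hL, hx]

/-! ### Lower semicontinuity and comparison of exponents -/

lemma fracTV_congr_ae {s : ℝ} {p : ℝ≥0∞} {u v : (Fin N → ℝ) → ℝ}
    (h : u =ᵐ[volume.restrict (cube N)] v) : fracTV s p u = fracTV s p v := by
  unfold fracTV variation
  refine iSup_congr fun φ => iSup_congr fun _ => ?_
  congr 1
  refine integral_congr_ae ?_
  filter_upwards [h] with x hx
  rw [hx]

lemma fracDiv_const_smul (s c : ℝ) (φ : (Fin N → ℝ) → (Fin N → ℝ)) (x : Fin N → ℝ) :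
    fracDiv s (fun y => c • φ y) x = c * fracDiv s φ x := by
  simp only [fracDiv, Pi.smul_apply, smul_eq_mul, rlPartialRight_const_mul, ← Finset.mul_sum]
  ring

/-- Signed unit vectors are admissible in the supremum; its boundedness is needed because an
unbounded real supremum has the value `0`. -/
lemma abs_apply_le_dualNorm {q : ℝ≥0∞} (hq : 1 ≤ q) (y : Fin N → ℝ) (i : Fin N) :
    |y i| ≤ dualNorm q y := by
  have : Fact (1 ≤ q) := ⟨hq⟩
  have hbdd : BddAbove {t : ℝ | ∃ x : Fin N → ℝ, ‖WithLp.toLp q x‖ ≤ 1 ∧ t = ∑ i, x i * y i} := by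
    refine ⟨∑ i, |y i|, ?_⟩
    rintro t ⟨x, hx, rfl⟩
    refine Finset.sum_le_sum fun i _ => (le_abs_self _).trans ?_
    rw [abs_mul]
    exact mul_le_of_le_one_left (abs_nonneg _) ((abs_apply_le_norm_toLp hq x i).trans hx)
  have key : ∀ σ : ℝ, |σ| = 1 → σ * y i ≤ dualNorm q y := by
    intro σ hσ
    refine le_csSup hbdd ⟨Pi.single i σ, ?_, ?_⟩
    · have h := PiLp.norm_single q (fun _ : Fin N => ℝ) i σ
      rw [Real.norm_eq_abs, hσ] at h
      exact h.le
    · rw [Finset.sum_eq_single i (fun j _ hj => by simp [hj]) (by simp)]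
      simp
  rcases abs_cases (y i) with h | h
  · simpa [h.1] using key 1 (by simp)
  · simpa [h.1] using key (-1) (by simp)

/-- Both norms dominate the sup norm, so each of the `N` products is at most `1/N`. This crude
comparison lets the bound for a single `p` control every exponent. -/
lemma dualNorm_inv_smul_le (hN : 1 ≤ N) {p q : ℝ≥0∞} (hp : 1 ≤ p) (hq : 1 ≤ q) {y : Fin N → ℝ}
    (hy : dualNorm q y ≤ 1) : dualNorm p ((N : ℝ)⁻¹ • y) ≤ 1 := by
  have hN' : (0 : ℝ) < N := by exact_mod_cast hN
  refine Real.sSup_le ?_ zero_le_one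
  rintro t ⟨x, hx, rfl⟩
  calc ∑ i, x i * ((N : ℝ)⁻¹ • y) i ≤ ∑ _i : Fin N, (N : ℝ)⁻¹ := by
        refine Finset.sum_le_sum fun i _ => (le_abs_self _).trans ?_
        rw [Pi.smul_apply, smul_eq_mul, abs_mul, abs_mul, abs_of_pos (inv_pos.2 hN')]
        have h1 := (abs_apply_le_norm_toLp hp x i).trans hx
        have h2 := (abs_apply_le_dualNorm hq y i).trans hy
        have h3 : (N : ℝ)⁻¹ * |y i| ≤ (N : ℝ)⁻¹ := mul_le_of_le_one_right (by positivity) h2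
        exact (mul_le_of_le_one_left (by positivity) h1).trans h3
    _ = 1 := by
        rw [Finset.sum_const, Finset.card_univ, Fintype.card_fin, nsmul_eq_mul,
          mul_inv_cancel₀ hN'.ne']

lemma IsTestField.inv_smul (hN : 1 ≤ N) {p q : ℝ≥0∞} (hp : 1 ≤ p) (hq : 1 ≤ q)
    {φ : (Fin N → ℝ) → (Fin N → ℝ)} (hφ : IsTestField q φ) :
    IsTestField p fun x => (N : ℝ)⁻¹ • φ x where
  smooth := hφ.smooth.const_smul (N : ℝ)⁻¹
  compactSupport := hφ.compactSupport.smul_left (f := fun _ => (N : ℝ)⁻¹)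
  support_subset := (tsupport_smul_subset_right (fun _ => (N : ℝ)⁻¹) φ).trans hφ.support_subset
  dualNorm_le x := dualNorm_inv_smul_le hN hp hq (hφ.dualNorm_le x)

/-- The fractional divergence of a test field must be bounded to pass to the limit under mere `L¹`
convergence. -/
lemma exists_fracDiv_eqOn {s : ℝ} (hs : s < 1) {q : ℝ≥0∞} {φ : (Fin N → ℝ) → (Fin N → ℝ)}
    (hφ : IsTestField q φ) : ∃ D : (Fin N → ℝ) → ℝ, Continuous D ∧ EqOn (fracDiv s φ) D (cube N) ∧
      ∃ C, ∀ x, |D x| ≤ C := by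
  have h1s : 0 < 1 - s := by linarith
  have hw : ∀ i, ContDiff ℝ 1 fun y => φ y i := fun i =>
    (contDiff_pi.1 hφ.smooth i).of_le (by exact_mod_cast le_top)
  have hc : ∀ i, HasCompactSupport fun y => φ y i := fun i =>
    hφ.compactSupport.comp_left (g := fun z : Fin N → ℝ => z i) rfl
  have h0 : ∀ i x, 1 ≤ x i → φ x i = 0 := by
    intro i x hx
    by_contra h
    have h' : φ x ≠ 0 := fun h'' => h (by rw [h'']; rfl)
    have := (hφ.support_subset (subset_tsupport _ h') i (mem_univ i)).2
    linarith
  choose C hC using fun i => exists_bound_of_hasCompactSupport (continuous_partialDeriv (hw i) i)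
    (hasCompactSupport_partialDeriv (hc i) i)
  refine ⟨fun x => divConst N s * ∑ i, -(1 / Real.Gamma (1 - s)) *
    dirFrac (1 - s) i (partialDeriv i fun y => φ y i) x, ?_, fun x hx => ?_,
    |divConst N s| * ∑ i, |1 / Real.Gamma (1 - s)| * ((∫ r, fracKernel (1 - s) r) * C i),
    fun x => ?_⟩
  · exact continuous_const.mul (continuous_finsetSum _ fun i _ => continuous_const.mul
      (continuous_dirFrac h1s i (continuous_partialDeriv (hw i) i) (hC i)))
  · rw [fracDiv, divConst]
    congr 1
    exact Finset.sum_congr rfl fun i _ => rlPartialRight_eq hs i (hw i) (hc i) (h0 i) hx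
  · rw [abs_mul]
    refine mul_le_mul_of_nonneg_left ((Finset.abs_sum_le_sum_abs _ _).trans
      (Finset.sum_le_sum fun i _ => ?_)) (abs_nonneg _)
    rw [abs_mul, abs_neg]
    exact mul_le_mul_of_nonneg_left (abs_lineFrac_le h1s fun t _ => hC i _) (abs_nonneg _)

/-- Lower semicontinuity of the fractional variations under `L¹` convergence, across exponents. -/
lemma fracTV_lt_top_of_tendsto (hN : 1 ≤ N) {s : ℝ} (hs : s < 1) {p q : ℝ≥0∞} (hp : 1 ≤ p)
    (hq : 1 ≤ q) {u : ℕ → (Fin N → ℝ) → ℝ} {v : (Fin N → ℝ) → ℝ}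
    (hu : ∀ n, IntegrableOn (u n) (cube N)) (hv : IntegrableOn v (cube N)) {R : ℝ}
    (hTV : ∀ n, fracTV s p (u n) < ⊤) (hR : ∀ n, (fracTV s p (u n)).toReal ≤ R)
    (ht : Tendsto (fun n => normL1 fun x => u n x - v x) atTop (𝓝 0)) :
    fracTV s q v < ⊤ := by
  have hN' : (0 : ℝ) < N := by exact_mod_cast hN
  refine lt_of_le_of_lt (iSup₂_le fun φ hφ => ENNReal.ofReal_le_ofReal (q := N * R) ?_)
    ENNReal.ofReal_lt_top
  obtain ⟨D, hD, hDe, C, hC⟩ := exists_fracDiv_eqOn hs hφ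
  have hcongr : ∀ w : (Fin N → ℝ) → ℝ, ∫ x in cube N, w x * fracDiv s φ x
      = ∫ x in cube N, w x * D x := fun w =>
    setIntegral_congr_fun measurableSet_cube fun x hx => by simp only [hDe hx]
  have hbound : ∀ n, ∫ x in cube N, u n x * D x ≤ N * R := by
    intro n
    have h1 := (integral_mul_fracDiv_le (hTV n) (hφ.inv_smul hN hp hq)).trans (hR n)
    have h2 : ∫ x in cube N, u n x * fracDiv s (fun x => (N : ℝ)⁻¹ • φ x) x
        = (N : ℝ)⁻¹ * ∫ x in cube N, u n x * fracDiv s φ x := by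
      rw [← integral_const_mul]
      congr 1 with x
      rw [fracDiv_const_smul]
      ring
    rw [h2, hcongr, inv_mul_le_iff₀ hN'] at h1
    exact h1
  rw [hcongr]
  have hsub : ∀ n, IntegrableOn (fun x => u n x - v x) (cube N) := fun n => (hu n).sub hv
  have ht' : Tendsto (fun n => ∫ x in cube N, |u n x - v x|) atTop (𝓝 0) := by
    have h := (ENNReal.tendsto_toReal ENNReal.zero_ne_top).comp ht
    refine h.congr fun n => ?_
    rw [Function.comp_apply, normL1_eq_ofReal (hsub n),
      ENNReal.toReal_ofReal (integral_nonneg fun _ => abs_nonneg _)]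
  have hle : ∀ n, ∫ x in cube N, v x * D x ≤ N * R + C * ∫ x in cube N, |u n x - v x| := by
    intro n
    have h1 := abs_setIntegral_mul_le (hsub n) fun x _ => hC x
    have i1 : IntegrableOn (fun x => u n x * D x) (cube N) :=
      (hu n).mul_bdd hD.aestronglyMeasurable (ae_of_all _ hC)
    have i2 : IntegrableOn (fun x => v x * D x) (cube N) :=
      hv.mul_bdd hD.aestronglyMeasurable (ae_of_all _ hC)
    have e : ∫ x in cube N, (u n x - v x) * D x
        = (∫ x in cube N, u n x * D x) - ∫ x in cube N, v x * D x := by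
      rw [← integral_sub i1 i2]
      congr 1 with x
      ring
    rw [e] at h1
    linarith [(abs_le.1 h1).1, hbound n]
  have hlim := (ht'.const_mul C).const_add (N * R)
  rw [mul_zero, add_zero] at hlim
  exact ge_of_tendsto' hlim hle

lemma translateIncr_eq_ofReal {u : (Fin N → ℝ) → ℝ} (hu : IntegrableOn u (cube N))
    (h : Fin N → ℝ) :
    translateIncr u h = ENNReal.ofReal (∫ x in shiftDomain h, |u (x + h) - u x|) := by
  have hi : IntegrableOn (fun x => u (x + h) - u x) (shiftDomain h) :=
    (integrableOn_translate hu h).sub (hu.mono_set fun x hx => hx.1)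
  rw [translateIncr, ← ofReal_integral_norm_eq_lintegral_enorm hi]
  rfl

/-! ### Compactness in `BV^s` -/

/-- Bounded sequences of functions of bounded fractional variation are relatively compact
in `L¹`. -/
theorem exists_subseq_of_fracBVNorm_le (hN : 1 ≤ N) {s : ℝ} (hs : s ∈ Ioo (0 : ℝ) 1)
    {p : ℝ≥0∞} (hp : 1 ≤ p) {u : ℕ → (Fin N → ℝ) → ℝ} (hi : ∀ n, IntegrableOn (u n) (cube N))
    {M : ℝ≥0∞} (hM : M < ⊤) (hu : ∀ n, fracBVNorm s p (u n) ≤ M) :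
    ∃ v : (Fin N → ℝ) → ℝ, MemFracBV s v ∧ ∃ k : ℕ → ℕ, StrictMono k ∧
      Tendsto (fun n => normL1 fun x => u (k n) x - v x) atTop (𝓝 0) := by
  -- Measurable representatives serve the Tonelli arguments; norms and variations depend only on the
  -- class almost everywhere.
  set w : ℕ → (Fin N → ℝ) → ℝ := fun n => (hi n).aestronglyMeasurable.mk (u n) with hw
  have hwm : ∀ n, Measurable (w n) := fun n =>
    (hi n).aestronglyMeasurable.stronglyMeasurable_mk.measurable
  have hae : ∀ n, u n =ᵐ[volume.restrict (cube N)] w n := fun n =>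
    (hi n).aestronglyMeasurable.ae_eq_mk
  have hwi : ∀ n, IntegrableOn (w n) (cube N) := fun n => (hi n).congr (hae n)
  have hwTV : ∀ n, fracTV s p (w n) = fracTV s p (u n) := fun n =>
    (fracTV_congr_ae (hae n)).symm
  have hTVM : ∀ n, fracTV s p (w n) ≤ M := fun n => by
    rw [hwTV]
    exact le_add_self.trans (hu n)
  have hTV : ∀ n, fracTV s p (w n) < ⊤ := fun n => (hTVM n).trans_lt hM
  have hTVr : ∀ n, (fracTV s p (w n)).toReal ≤ M.toReal := fun n =>
    ENNReal.toReal_mono hM.ne (hTVM n)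
  have hnorm : ∀ n, ∫ x in cube N, |w n x| ≤ M.toReal := fun n => by
    have h1 : normL1 (w n) ≤ M := by
      have : normL1 (w n) = normL1 (u n) := (eLpNorm_congr_ae (hae n)).symm
      rw [this]
      exact le_self_add.trans (hu n)
    rw [normL1_eq_ofReal (hwi n)] at h1
    exact (ENNReal.ofReal_le_iff_le_toReal hM.ne).1 h1
  obtain ⟨A, hA, H⟩ := exists_setIntegral_translate_sub_le hN hs
  obtain ⟨v, hv, k, hk, ht⟩ := exists_tendsto_subseq hwm hwi hnorm fun η hη => by
    have hlim := (tendsto_kernelModulus hs.1).const_mul A |>.mul_const (M.toReal + M.toReal)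
    rw [mul_zero, zero_mul] at hlim
    obtain ⟨ρ, hρ, hρ'⟩ := Metric.eventually_nhds_iff.1 (hlim.eventually (gt_mem_nhds hη))
    refine ⟨ρ, hρ, fun n i t ht => ?_⟩
    rw [translateIncr_eq_ofReal (hwi n)]
    refine ENNReal.ofReal_le_ofReal ((H i t hp (hwi n) (hTV n)).trans (le_trans ?_
      (hρ' (y := t) (by simpa using ht)).le))
    refine mul_le_mul_of_nonneg_left (add_le_add (hnorm n) (hTVr n)) (mul_nonneg hA ?_)
    exact integral_nonneg fun _ => abs_nonneg _
  refine ⟨v, ⟨hv, fun q hq => ?_⟩, k, hk, ?_⟩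
  · exact fracTV_lt_top_of_tendsto hN hs.2 hp hq (fun n => hwi (k n)) hv (fun n => hTV (k n))
      (fun n => hTVr (k n)) ht
  · refine ht.congr fun n => eLpNorm_congr_ae ?_
    filter_upwards [hae (k n)] with x hx
    rw [hx]

end FracBV

end

theorem theorem4p2 (N : ℕ) (hN : 1 ≤ N) (s : ℝ) (hs : s ∈ Set.Ioo (0 : ℝ) 1)
    (p : ℝ≥0∞) (hp : 1 ≤ p) (u : ℕ → (Fin N → ℝ) → ℝ)
    (hSV : ∀ n, FracBV.MemSV s (u n)) (hBV : ∀ n, FracBV.MemBV (u n))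
    (hbound : (⨆ n, (FracBV.boundaryNorm (u n) + FracBV.fracBVNorm s p (u n))) < ⊤) :
    ∃ v : (Fin N → ℝ) → ℝ, FracBV.MemFracBV s v ∧
      ∃ k : ℕ → ℕ, StrictMono k ∧
        Tendsto (fun n => FracBV.normL1 (fun x => u (k n) x - v x)) atTop (𝓝 0) :=
  FracBV.exists_subseq_of_fracBVNorm_le hN hs hp (fun n => (hBV n).1) hbound fun n =>
    le_add_self.trans (le_iSup
      (fun n => FracBV.boundaryNorm (u n) + FracBV.fracBVNorm s p (u n)) n)
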